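/- Write $\mathbb{C}^n$ with its Euclidean norm. For an open set $U\subset\mathbb{C}^n$, $\mathcal{PSH}(U)$ denotes the set of plurisubharmonic functions on $U$, and, for $k\in\{0,1\}$, $\mathcal{C}^k(U)$ denotes the set of $\mathcal{C}^k$-smooth real-valued functions on $U$. A function $\varphi$ is called strictly plurisubharmonic on $U$ if for every $\mathcal{C}^\infty$-smooth function $\theta\colon U\to\mathbb{R}$ with compact support there is $\varepsilon_0>0$ such that $\varphi+\varepsilon\theta$ is plurisubharmonic on $U$ for all $\varepsilon\in(-\varepsilon_0,\varepsilon_0)$. A pseudoconvex domain is a nonempty connected open set that admits a continuous plurisubharmonic exhaustion function. For a domain $\Omega\subset\mathbb{C}^n$ let $\mathfrak{c}^k(\Omega)$ be the set of all $z\in\Omega$ such that no function $\varphi\in\mathcal{PSH}(\Omega)\cap\mathcal{C}^k(\Omega)$ that is bounded from above is strictly plurisubharmonic on some open neighborhood $U\subset\Omega$ of $z$. **Theorem 2.** For every $n\ge 2$, there exist a pseudoconvex domain $\Omega\subset\mathbb{C}^n$ and a nonempty open set $\omega\subset\Omega$ such that the following assertions hold true: 1. There exists a function $\varphi\in\mathcal{PSH}(\Omega)\cap\mathcal{C}^0(\Omega)$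 such that $\varphi<0$ on $\Omega$ and $\varphi$ is strictly plurisubharmonic on $\omega$. 2. Every function $\varphi\in\mathcal{PSH}(\Omega)\cap\mathcal{C}^1(\Omega)$ such that $\varphi<0$ on $\Omega$ is constant on $\omega$. In particular, $\mathfrak{c}^0(\Omega)\neq\mathfrak{c}^1(\Omega)$. -/

import Mathlib

/-- `f` is a (real-valued) plurisubharmonic function on the open set `U ⊆ ℂⁿ`: it is upper
semicontinuous, and on every closed disc `{a + ζ b : |ζ| ≤ 1} ⊆ U` in a complex line it satisfies
the sub-mean value inequality. For a function with values in `ℝ`, as here, this inequality forces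
the integral over the circle to be finite, which is why integrability is part of the
condition. -/
def IsPSHOn {n : ℕ} (f : EuclideanSpace ℂ (Fin n) → ℝ) (U : Set (EuclideanSpace ℂ (Fin n))) :
    Prop :=
  UpperSemicontinuousOn f U ∧
    ∀ a b : EuclideanSpace ℂ (Fin n), (∀ ζ : ℂ, ‖ζ‖ ≤ 1 → a + ζ • b ∈ U) →
      CircleIntegrable (fun ζ : ℂ => f (a + ζ • b)) 0 1 ∧
        f a ≤ Real.circleAverage (fun ζ : ℂ => f (a + ζ • b)) 0 1

/-- `f` belongs to `PSH(U) ∩ C^k(U)`, for `k ∈ {0, 1, 2, …} ∪ {∞}`. -/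
def IsPSHOfClassOn {n : ℕ} (k : ℕ∞) (f : EuclideanSpace ℂ (Fin n) → ℝ)
    (U : Set (EuclideanSpace ℂ (Fin n))) : Prop :=
  IsPSHOn f U ∧ ContDiffOn ℝ k f U

/-- `f` is strictly plurisubharmonic on the open set `U`: for every smooth real function `θ` with
compact support in `U`, the function `f + ε θ` is plurisubharmonic on `U` for all real `ε` with
sufficiently small absolute value. -/
def IsStrictlyPSHOn {n : ℕ} (f : EuclideanSpace ℂ (Fin n) → ℝ)
    (U : Set (EuclideanSpace ℂ (Fin n))) : Prop :=
  ∀ θ : EuclideanSpace ℂ (Fin n) → ℝ, ContDiff ℝ (⊤ : ℕ∞) θ → HasCompactSupport θ → tsupport θ ⊆ U →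
    ∃ ε₀ : ℝ, 0 < ε₀ ∧ ∀ ε : ℝ, |ε| < ε₀ → IsPSHOn (fun z => f z + ε * θ z) U

/-- The core `𝔠^k(Ω)`: the points of `Ω` near which every plurisubharmonic function of class `C^k`
on `Ω` that is bounded from above fails to be strictly plurisubharmonic. -/
def pshCore {n : ℕ} (k : ℕ∞) (Ω : Set (EuclideanSpace ℂ (Fin n))) :
    Set (EuclideanSpace ℂ (Fin n)) :=
  {z | z ∈ Ω ∧ ∀ f : EuclideanSpace ℂ (Fin n) → ℝ, IsPSHOfClassOn k f Ω → BddAbove (f '' Ω) →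
    ¬ ∃ U : Set (EuclideanSpace ℂ (Fin n)), IsOpen U ∧ z ∈ U ∧ U ⊆ Ω ∧ IsStrictlyPSHOn f U}

/-- `Ω` is a pseudoconvex domain: a nonempty connected open set which has a continuous
plurisubharmonic exhaustion function. -/
def IsPseudoconvexDomain {n : ℕ} (Ω : Set (EuclideanSpace ℂ (Fin n))) : Prop :=
  IsOpen Ω ∧ IsConnected Ω ∧
    ∃ u : EuclideanSpace ℂ (Fin n) → ℝ, ContinuousOn u Ω ∧ IsPSHOn u Ω ∧
      ∀ c : ℝ, IsCompact {z | z ∈ Ω ∧ u z ≤ c}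

/-!
The domain `Ω` is assembled from pieces that a bounded plurisubharmonic function of class `C¹`
sees as one entire curve, while a merely continuous one can tell them apart. Fix a dense sequence
`p j` in the unit circle. The domain contains the complex hyperplanes `x 0 = p j` (the leaves), a
neighbourhood of the disc `{(ζ, 0, …, 0) : |ζ| ≤ 1}`, and the exterior curve `{(ζ, ζ⁻¹, 0, …, 0) :
|ζ| ≥ 1}`; away from small neighbourhoods of the leaves, the part of `Ω` near the disc and the part
near the curve are separated from each other (`exists_domain`). It is a component of an increasing
union of regions given by inequalities `weight · |h| < 1`, where the weight is a product of
fractional powers of the distances `|x 0 - p j|` and `h` is a polynomial. The maximum principle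
gives such a region the property that a holomorphic disc with boundary in the region lies in the
region (`hasDiscProperty_weightedRegion`), whence `-log dist(·, Ωᶜ)` is plurisubharmonic and `Ω`
is pseudoconvex (`HasDiscProperty.isPseudoconvexDomain`).

*Rigidity of class `C¹`.* Let `φ` be plurisubharmonic of class `C¹` and bounded above on `Ω`. On
each leaf `φ` is constant by Liouville's theorem (`eq_on_leaf`), so the sub-mean value inequality is
an equality for discs in the leaf, and its first variation vanishes as well. This makes the normal
derivative of `φ` harmonic along the leaf and orthogonal to all first moments, hence constant: the
differential of `φ` is constant on each leaf (`fderiv_eq_on_leaf`). As the `p j` are dense, over the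
whole circle `|x 0| = 1` both `φ` and its differential depend only on `x 0`. Therefore `φ` along the
disc `ζ ↦ (ζ, w)`, `|ζ| ≤ 1`, continued by `φ` along the exterior curve, is a continuous function
on the plane that is bounded above, satisfies a sub-mean value inequality off the circle, and is
differentiable on the circle. Differentiability is enough for the maximum principle to hold across
the circle, and Liouville's theorem applies again (`eq_of_asymSubMeanAt_or_differentiableAt`). So
`φ` takes on every such disc its value at one fixed point of the exterior curve
(`eq_of_disc_of_exterior_curve`), that is, `φ` is constant near the origin.

*Flexibility of class `C⁰`.* The functions `|z|² - 1` and `-log |z|` agree on the circle but have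
different derivatives there. Countably many small modifications make them agree near every `p j`,
keeping them subharmonic where needed (`exists_pair_eq_near`). The first one is then used on the
part of `Ω` near the disc and the second one on the part near the exterior curve; the two
definitions agree near the leaves. Near the origin `|x 0|²` is traded for a multiple of `‖x‖²`,
and the result is strictly plurisubharmonic there (`exists_psh_isStrictlyPSHOn`).

For a continuous function, plurisubharmonicity is verified through the sub-mean value inequality on
small discs around each point (`LocalSubMeanAt`, `isPSHOn_of_localSubMeanAt`).
-/

open Filter Topology Metric Set
open Real (circleAverage)

/-! ### Averages over the unit circle -/

theorem avg_mono {f g : ℂ → ℝ} (hf : ContinuousOn f (sphere 0 1))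
    (hg : ContinuousOn g (sphere 0 1)) (h : ∀ ζ : ℂ, ‖ζ‖ = 1 → f ζ ≤ g ζ) :
    circleAverage f 0 1 ≤ circleAverage g 0 1 :=
  Real.circleAverage_mono (hf.circleIntegrable zero_le_one) (hg.circleIntegrable zero_le_one)
    (fun ζ hζ => h ζ (by simpa using hζ))

theorem avg_congr {f g : ℂ → ℝ} (h : ∀ ζ : ℂ, ‖ζ‖ = 1 → f ζ = g ζ) :
    circleAverage f 0 1 = circleAverage g 0 1 :=
  Real.circleAverage_congr_sphere (fun ζ hζ => h ζ (by simpa using hζ))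

theorem avg_le {f : ℂ → ℝ} (hf : ContinuousOn f (sphere 0 1)) {m : ℝ}
    (h : ∀ ζ : ℂ, ‖ζ‖ = 1 → f ζ ≤ m) : circleAverage f 0 1 ≤ m :=
  Real.circleAverage_mono_on_of_le_circle (hf.circleIntegrable zero_le_one)
    (fun ζ hζ => h ζ (by simpa using hζ))

theorem avg_add {f g : ℂ → ℝ} (hf : ContinuousOn f (sphere 0 1))
    (hg : ContinuousOn g (sphere 0 1)) :
    circleAverage (fun ζ => f ζ + g ζ) 0 1 = circleAverage f 0 1 + circleAverage g 0 1 :=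
  Real.circleAverage_fun_add (hf.circleIntegrable zero_le_one) (hg.circleIntegrable zero_le_one)

theorem avg_sub {f g : ℂ → ℝ} (hf : ContinuousOn f (sphere 0 1))
    (hg : ContinuousOn g (sphere 0 1)) :
    circleAverage (fun ζ => f ζ - g ζ) 0 1 = circleAverage f 0 1 - circleAverage g 0 1 :=
  Real.circleAverage_fun_sub (hf.circleIntegrable zero_le_one) (hg.circleIntegrable zero_le_one)

theorem avg_const (m : ℝ) : circleAverage (fun _ : ℂ => m) 0 1 = m :=
  Real.circleAverage_const m 0 1

theorem avg_const_mul (m : ℝ) (f : ℂ → ℝ) :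
    circleAverage (fun ζ => m * f ζ) 0 1 = m * circleAverage f 0 1 := by
  simpa [smul_eq_mul] using (Real.circleAverage_fun_smul (a := m) (f := f) (c := 0) (R := 1))

theorem le_avg {f : ℂ → ℝ} (hf : ContinuousOn f (sphere 0 1)) {m : ℝ}
    (h : ∀ ζ : ℂ, ‖ζ‖ = 1 → m ≤ f ζ) : m ≤ circleAverage f 0 1 := by
  rw [← avg_const m]; exact avg_mono continuousOn_const hf h

/-- Rotating the circle does not change the average. -/
theorem avg_neg (f : ℂ → ℝ) :
    circleAverage (fun ζ => f (-ζ)) 0 1 = circleAverage f 0 1 := by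
  rw [Real.circleAverage_eq_integral_add Real.pi (f := f), Real.circleAverage]
  congr 2
  funext θ
  congr 1
  simp [circleMap, add_mul, Complex.exp_add]

/-- A function which is midpoint convex at `0` in every direction is bounded there by its
average. -/
theorem le_avg_of_midpoint {f : ℂ → ℝ} (hf : ContinuousOn f (sphere 0 1)) {m : ℝ}
    (h : ∀ ζ : ℂ, ‖ζ‖ = 1 → 2 * m ≤ f ζ + f (-ζ)) : m ≤ circleAverage f 0 1 := by
  have hf' : ContinuousOn (fun ζ => f (-ζ)) (sphere 0 1) :=
    hf.comp continuous_neg.continuousOn (fun ζ hζ => by simpa using hζ)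
  have := le_avg (hf.add hf') h
  have h2 := avg_add hf hf'
  rw [avg_neg] at h2
  have h3 : circleAverage (f + fun ζ => f (-ζ)) 0 1 = circleAverage (fun ζ => f ζ + f (-ζ)) 0 1 :=
    rfl
  linarith

theorem avg_re_of_differentiable {p : ℂ → ℂ} (hp : Differentiable ℂ p) :
    circleAverage (fun ζ => (p ζ).re) 0 1 = (p 0).re := by
  have h1 : circleAverage p 0 1 = p 0 := DiffContOnCl.circleAverage hp.diffContOnCl
  have h2 := Complex.reCLM.circleAverage_comp_comm (f := p) (c := 0) (R := 1)
    (hp.continuous.continuousOn.circleIntegrable zero_le_one)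
  rw [h1] at h2
  exact h2

/-- Averages of `L (ζ ^ 2 • c)` vanish for real linear `L`. -/
theorem avg_sq {E : Type*} [NormedAddCommGroup E] [NormedSpace ℂ E] (L : E →L[ℝ] ℝ) (c : E) :
    circleAverage (fun ζ => L (ζ ^ 2 • c)) 0 1 = 0 := by
  have h := Real.circleAverage_eq_integral_add (Real.pi / 2) (c := 0) (R := 1)
    (f := fun ζ : ℂ => L (ζ ^ 2 • c))
  have h2 : circleAverage (fun ζ => - L (ζ ^ 2 • c)) 0 1
      = circleAverage (fun ζ => L (ζ ^ 2 • c)) 0 1 := by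
    rw [h, Real.circleAverage]
    congr 2
    funext θ
    have : circleMap 0 1 (θ + Real.pi / 2) ^ 2 = - circleMap 0 1 θ ^ 2 := by
      simp [circleMap, add_mul, Complex.exp_add, mul_pow, Complex.exp_pi_div_two_mul_I]
    rw [this]
    simp
  have h3 := avg_const_mul (-1) (fun ζ : ℂ => L (ζ ^ 2 • c))
  simp only [neg_mul, one_mul] at h3
  linarith

theorem avg_norm_sq (a : ℂ) (t : ℝ) :
    circleAverage (fun ζ : ℂ => ‖a + t * ζ‖ ^ 2) 0 1 = ‖a‖ ^ 2 + t ^ 2 := by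
  have key : ∀ ζ : ℂ, ‖ζ‖ = 1 →
      ‖a + t * ζ‖ ^ 2 = (‖a‖ ^ 2 + t ^ 2) + ((2 * t * starRingEnd ℂ a) * ζ).re := by
    intro ζ hζ
    have h1 : ζ.re ^ 2 + ζ.im ^ 2 = 1 := by
      have := Complex.sq_norm ζ
      rw [hζ, Complex.normSq_apply] at this
      nlinarith
    rw [Complex.sq_norm, Complex.sq_norm, Complex.normSq_apply, Complex.normSq_apply]
    simp
    linear_combination t ^ 2 * h1
  rw [avg_congr key, avg_add continuousOn_const (by fun_prop), avg_const,
    avg_re_of_differentiable (p := fun ζ => (2 * t * starRingEnd ℂ a) * ζ) (by fun_prop)]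
  simp

/-! ### The maximum principle -/

/-- A function on a compact set of the plane is bounded by `m` if it is so at all points at which
some perturbation `U + δ ‖·‖²` has a local maximum. -/
theorem le_of_no_isLocalMax {U : ℂ → ℝ} {K : Set ℂ} (hK : IsCompact K) (hU : ContinuousOn U K)
    {m : ℝ} (h : ∀ y ∈ K, U y ≤ m ∨
      (K ∈ 𝓝 y ∧ ∀ δ > 0, ¬ IsLocalMax (fun z => U z + δ * ‖z‖ ^ 2) y)) :
    ∀ y ∈ K, U y ≤ m := by
  intro y hy
  obtain ⟨R, hR⟩ := hK.isBounded.exists_norm_le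
  refine le_of_forall_pos_le_add fun ε hε => ?_
  set δ := ε / (R ^ 2 + 1)
  have hδ : 0 < δ := by positivity
  obtain ⟨w, hw, hmax⟩ := hK.exists_isMaxOn ⟨y, hy⟩
    (f := fun z => U z + δ * ‖z‖ ^ 2) (by fun_prop)
  have h1 : U y + δ * ‖y‖ ^ 2 ≤ U w + δ * ‖w‖ ^ 2 := hmax hy
  have h2 : U w ≤ m := by
    rcases h w hw with h2 | ⟨h2, h3⟩
    · exact h2
    · exact absurd (hmax.isLocalMax h2) (h3 δ hδ)
  have h3 : δ * ‖w‖ ^ 2 ≤ ε := by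
    have : ‖w‖ ^ 2 ≤ R ^ 2 := pow_le_pow_left₀ (norm_nonneg _) (hR w hw) 2
    calc δ * ‖w‖ ^ 2 ≤ δ * (R ^ 2 + 1) := by gcongr; linarith
      _ = ε := by simp only [δ]; field_simp
  have : 0 ≤ δ * ‖y‖ ^ 2 := by positivity
  linarith

/-- The sub-mean value inequality at `z`, up to an error which is small compared with the square
of the radius. This is what survives when a plurisubharmonic function of class `C¹` is restricted
to a holomorphic curve, and it still forces the maximum principle. -/
def AsymSubMeanAt (u : ℂ → ℝ) (z : ℂ) : Prop :=
  ∀ δ > 0, ∀ᶠ t : ℝ in 𝓝[>] 0,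
    u z ≤ circleAverage (fun ζ : ℂ => u (z + t * ζ)) 0 1 + δ * t ^ 2

theorem eventually_circle {z : ℂ} {p : ℂ → Prop} (h : ∀ᶠ y in 𝓝 z, p y) :
    ∀ᶠ t : ℝ in 𝓝[>] 0, ∀ ζ : ℂ, ‖ζ‖ ≤ 1 → p (z + t * ζ) := by
  obtain ⟨r, hr, hp⟩ := Metric.eventually_nhds_iff.1 h
  filter_upwards [Ioo_mem_nhdsGT hr] with t ht ζ hζ
  apply hp
  rw [dist_eq_norm, add_sub_cancel_left, norm_mul, Complex.norm_real, Real.norm_of_nonneg ht.1.le]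
  nlinarith [ht.1, ht.2, norm_nonneg ζ]

theorem continuousOn_circle {u : ℂ → ℝ} {z : ℂ} {t : ℝ}
    (h : ∀ ζ : ℂ, ‖ζ‖ ≤ 1 → ContinuousAt u (z + t * ζ)) :
    ContinuousOn (fun ζ : ℂ => u (z + t * ζ)) (sphere 0 1) := by
  intro ζ hζ
  have := h ζ (by simpa using (mem_sphere_zero_iff_norm.1 hζ).le)
  exact (ContinuousAt.comp (f := fun ζ : ℂ => z + t * ζ) this (by fun_prop)).continuousWithinAt

theorem AsymSubMeanAt.not_isLocalMax {u : ℂ → ℝ} {z : ℂ} (hu : AsymSubMeanAt u z)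
    (hc : ∀ᶠ y in 𝓝 z, ContinuousAt u y) {δ : ℝ} (hδ : 0 < δ) :
    ¬ IsLocalMax (fun y => u y + δ * ‖y‖ ^ 2) z := by
  intro hmax
  have h0 : ∀ᶠ t : ℝ in 𝓝[>] 0, 0 < t := self_mem_nhdsWithin
  obtain ⟨t, ht, h1, h2, h3⟩ := ((h0.and ((hu (δ / 2) (by positivity)).and
    ((eventually_circle hc).and (eventually_circle hmax)))).exists)
  have hcont := continuousOn_circle h2
  have h4 := avg_le (f := fun ζ : ℂ => u (z + t * ζ) + δ * ‖z + t * ζ‖ ^ 2)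
    (hcont.add (by fun_prop)) (fun ζ hζ => h3 ζ hζ.le)
  rw [avg_add hcont (by fun_prop), avg_const_mul, avg_norm_sq] at h4
  nlinarith [sq_nonneg t, mul_pos hδ (pow_pos ht 2)]

/-- The exact sub-mean value inequality on all small circles implies the asymptotic one. -/
theorem asymSubMeanAt_of_eventually {u : ℂ → ℝ} {z : ℂ}
    (h : ∀ᶠ t : ℝ in 𝓝[>] 0, u z ≤ circleAverage (fun ζ : ℂ => u (z + t * ζ)) 0 1) :
    AsymSubMeanAt u z := by
  intro δ hδ
  filter_upwards [h] with t ht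
  have : 0 ≤ δ * t ^ 2 := by positivity
  linarith

theorem AsymSubMeanAt.add {u v : ℂ → ℝ} {z : ℂ} (hu : AsymSubMeanAt u z) (hv : AsymSubMeanAt v z)
    (hcu : ∀ᶠ y in 𝓝 z, ContinuousAt u y) (hcv : ∀ᶠ y in 𝓝 z, ContinuousAt v y) :
    AsymSubMeanAt (fun y => u y + v y) z := by
  intro δ hδ
  filter_upwards [hu (δ / 2) (by positivity), hv (δ / 2) (by positivity), eventually_circle hcu,
    eventually_circle hcv] with t h1 h2 h3 h4
  rw [avg_add (continuousOn_circle h3) (continuousOn_circle h4)]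
  linarith

theorem asymSubMeanAt_re {p : ℂ → ℂ} (hp : Differentiable ℂ p) (z : ℂ) :
    AsymSubMeanAt (fun y => (p y).re) z := by
  refine asymSubMeanAt_of_eventually (Eventually.of_forall fun t => ?_)
  rw [avg_re_of_differentiable (p := fun ζ => p (z + t * ζ)) (by fun_prop)]
  simp

/-- The mean value property of `log ‖b + ζ c‖` over the unit circle, when it has no singularity
in the closed disc. -/
theorem avg_log_norm {b c : ℂ} (h : ∀ ζ : ℂ, ‖ζ‖ ≤ 1 → b + ζ * c ≠ 0) :
    circleAverage (fun ζ : ℂ => Real.log ‖b + ζ * c‖) 0 1 = Real.log ‖b‖ := by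
  have := InnerProductSpace.HarmonicOnNhd.circleAverage_eq (c := 0) (R := 1)
    (f := fun ζ : ℂ => Real.log ‖b + ζ * c‖) (fun ζ hζ =>
      AnalyticAt.harmonicAt_log_norm (f := fun ζ => b + ζ * c) (by fun_prop)
        (h ζ (by simpa using hζ)))
  simpa using this

theorem asymSubMeanAt_log (s : ℝ) {p z : ℂ} (h : z ≠ p) :
    AsymSubMeanAt (fun y => s * Real.log ‖y - p‖) z := by
  refine asymSubMeanAt_of_eventually ?_
  have h1 : ∀ᶠ y in 𝓝 z, y ≠ p := isOpen_ne.mem_nhds h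
  filter_upwards [eventually_circle h1] with t ht
  have h2 := avg_log_norm (b := z - p) (c := t) (fun ζ hζ => by
    have := ht ζ hζ
    rw [mul_comm, ← sub_ne_zero] at this
    intro h0; apply this; rw [← h0]; ring)
  rw [avg_const_mul, ← h2]
  apply le_of_eq
  congr 2
  funext ζ
  congr 2
  ring

/-- On the closed unit disc, the local sub-mean value inequality implies the maximum principle. -/
theorem le_of_asymSubMeanAt_disc {U : ℂ → ℝ} (hU : ContinuousOn U (closedBall 0 1))
    (h : ∀ z ∈ ball (0 : ℂ) 1, AsymSubMeanAt U z) {m : ℝ} (hm : ∀ ζ : ℂ, ‖ζ‖ = 1 → U ζ ≤ m) :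
    ∀ z ∈ closedBall (0 : ℂ) 1, U z ≤ m := by
  refine le_of_no_isLocalMax (isCompact_closedBall 0 1) hU fun y hy => ?_
  by_cases h1 : ‖y‖ = 1
  · exact Or.inl (hm y h1)
  · have h2 : y ∈ ball (0 : ℂ) 1 := by
      simp at hy ⊢; exact lt_of_le_of_ne hy h1
    refine Or.inr ⟨mem_of_superset (isOpen_ball.mem_nhds h2) ball_subset_closedBall,
      fun δ hδ => (h y h2).not_isLocalMax ?_ hδ⟩
    filter_upwards [isOpen_ball.mem_nhds h2] with w hw
    exact hU.continuousAt (mem_of_superset (isOpen_ball.mem_nhds hw) ball_subset_closedBall)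

/-! ### Approximation on the circle by real parts of entire functions -/

/-- Every trigonometric polynomial has, after multiplication by any constant, the real part of an
entire function as its real part. -/
theorem exists_entire_re_eq_of_mem_span {g : C(AddCircle (1 : ℝ), ℂ)}
    (hg : g ∈ Submodule.span ℂ (range (@fourier (1 : ℝ)))) (c : ℂ) :
    ∃ p : ℂ → ℂ, Differentiable ℂ p ∧
      ∀ x : AddCircle (1 : ℝ), (c * g x).re = (p (AddCircle.toCircle x)).re := by
  induction hg using Submodule.span_induction generalizing c with
  | mem g hg =>
    obtain ⟨n, rfl⟩ := hg
    obtain ⟨m, rfl | rfl⟩ := n.eq_nat_or_neg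
    · refine ⟨fun ζ => c * ζ ^ m, by fun_prop, fun x => ?_⟩
      simp [fourier_apply, AddCircle.toCircle_nsmul]
    · refine ⟨fun ζ => starRingEnd ℂ c * ζ ^ m, by fun_prop, fun x => ?_⟩
      rw [← Complex.conj_re]
      simp only [fourier_apply, neg_smul, AddCircle.toCircle_neg, Circle.coe_inv_eq_conj,
        map_mul, Complex.conj_conj, natCast_zsmul, AddCircle.toCircle_nsmul, Circle.coe_pow]
  | zero => exact ⟨fun _ => 0, by fun_prop, fun x => by simp⟩
  | add g₁ g₂ _ _ h₁ h₂ =>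
    obtain ⟨p₁, hp₁, h₁⟩ := h₁ c
    obtain ⟨p₂, hp₂, h₂⟩ := h₂ c
    refine ⟨fun ζ => p₁ ζ + p₂ ζ, by fun_prop, fun x => ?_⟩
    rw [ContinuousMap.add_apply, mul_add, Complex.add_re, h₁, h₂, Complex.add_re]
  | smul a g _ h =>
    obtain ⟨p, hp, h⟩ := h (c * a)
    refine ⟨p, hp, fun x => ?_⟩
    rw [← h, ContinuousMap.smul_apply, smul_eq_mul, mul_assoc]

theorem exists_entire_re_approx {f : ℂ → ℝ} (hf : ContinuousOn f (sphere 0 1)) {ε : ℝ}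
    (hε : 0 < ε) : ∃ p : ℂ → ℂ, Differentiable ℂ p ∧
      ∀ ζ : ℂ, ‖ζ‖ = 1 → |f ζ - (p ζ).re| < ε := by
  have hc : Continuous fun x : AddCircle (1 : ℝ) => (f (AddCircle.toCircle x) : ℂ) := by
    refine Complex.continuous_ofReal.comp ?_
    refine hf.comp_continuous (by fun_prop)
      (fun x => by simp [Circle.norm_coe])
  set g : C(AddCircle (1 : ℝ), ℂ) := ⟨_, hc⟩
  have hmem : g ∈ (Submodule.span ℂ (range (@fourier (1 : ℝ)))).topologicalClosure := by
    rw [span_fourier_closure_eq_top]; trivial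
  obtain ⟨h, hh, hgh⟩ := Metric.mem_closure_iff.1 hmem ε hε
  obtain ⟨p, hp, hph⟩ := exists_entire_re_eq_of_mem_span hh 1
  refine ⟨p, hp, fun ζ hζ => ?_⟩
  obtain ⟨x, hx⟩ := (AddCircle.homeomorphCircle (T := 1) one_ne_zero).surjective
    (⟨ζ, by simpa [Submonoid.unitSphere] using hζ⟩ : Circle)
  rw [AddCircle.homeomorphCircle_apply] at hx
  have hx' : (AddCircle.toCircle x : ℂ) = ζ := by rw [hx]
  have h1 : ‖g x - h x‖ < ε := by
    rw [← dist_eq_norm]; exact lt_of_le_of_lt (ContinuousMap.dist_apply_le_dist x) hgh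
  have h2 := hph x
  rw [one_mul, hx'] at h2
  rw [← h2]
  have h3 : f ζ - (h x).re = (g x - h x).re := by simp [g, hx']
  rw [h3]
  exact lt_of_le_of_lt (Complex.abs_re_le_norm _) h1

/-- For functions continuous on the closed disc, the sub-mean value inequality on small circles
implies the one on the unit circle: subtract the real part of an entire function which is close to
the given function on the circle and apply the maximum principle. -/
theorem le_avg_of_asymSubMeanAt {u : ℂ → ℝ} (hu : ContinuousOn u (closedBall 0 1))
    (h : ∀ z ∈ ball (0 : ℂ) 1, AsymSubMeanAt u z) : u 0 ≤ circleAverage u 0 1 := by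
  refine le_of_forall_pos_le_add fun ε hε => ?_
  have hus := hu.mono sphere_subset_closedBall
  obtain ⟨p, hp, hpu⟩ := exists_entire_re_approx hus (half_pos hε)
  have hpc : Continuous fun y => (-p y).re := by
    have := hp.continuous
    fun_prop
  have h1 : u 0 + (-p 0).re ≤ ε / 2 := by
    refine le_of_asymSubMeanAt_disc (U := fun y => u y + (-p y).re)
      (hu.add hpc.continuousOn) (fun z hz => ?_) (fun ζ hζ => ?_) 0 (by simp)
    · refine (h z hz).add (asymSubMeanAt_re (p := fun y => -p y) (by fun_prop) z) ?_
        (Eventually.of_forall fun y => hpc.continuousAt)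
      filter_upwards [isOpen_ball.mem_nhds hz] with w hw
      exact hu.continuousAt (mem_of_superset (isOpen_ball.mem_nhds hw) ball_subset_closedBall)
    · have := (abs_lt.1 (hpu ζ hζ)).2
      simp only [Complex.neg_re]
      linarith
  have h2 : (p 0).re - ε / 2 ≤ circleAverage u 0 1 := by
    rw [← avg_re_of_differentiable hp, ← avg_const (ε / 2), ← avg_sub _ continuousOn_const]
    · refine avg_mono ?_ hus (fun ζ hζ => ?_)
      · have := hp.continuous
        fun_prop
      · have := (abs_lt.1 (hpu ζ hζ)).1
        linarith
    · have := hp.continuous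
      fun_prop
  simp only [Complex.neg_re] at h1
  linarith

/-! ### A Liouville theorem for functions glued along the unit circle -/

/-- At a point of the unit circle, a term `ε log⁺ |y|` prevents a local maximum of the sum with
differentiable functions, as its radial derivative jumps upwards. -/
theorem not_isLocalMax_of_kink {u v : ℂ → ℝ} {z : ℂ} (hz : ‖z‖ = 1) {L : ℂ →L[ℝ] ℝ}
    (hu : HasFDerivAt u L z) {ε : ℝ} (hε : 0 < ε) {L' : ℂ →L[ℝ] ℝ} (hv : HasFDerivAt v L' z) :
    ¬ IsLocalMax (fun y => u y + ε * Real.posLog ‖y‖ + v y) z := by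
  intro hmax
  have hz0 : z ≠ 0 := by rintro rfl; simp at hz
  -- the functions along the ray through `z`, on both sides of the circle
  have hline : ∀ s : ℝ, HasDerivAt (fun s : ℝ => z + (s : ℂ) * z) z s := fun s => by
    simpa using (((hasDerivAt_id s).ofReal_comp).mul_const z).const_add z
  have hW : HasFDerivAt (fun y => u y + v y) (L + L') z := hu.add hv
  have hW' : HasDerivAt (fun s : ℝ => u (z + s * z) + v (z + s * z)) ((L + L') z) 0 := by
    have h0 : HasFDerivAt (fun y => u y + v y) (L + L') (z + ((0 : ℝ) : ℂ) * z) := by simpa using hW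
    exact h0.comp_hasDerivAt (0 : ℝ) (hline 0)
  have hnorm : ∀ s : ℝ, ‖z + s * z‖ = |1 + s| := fun s => by
    have : z + s * z = ((1 + s : ℝ) : ℂ) * z := by push_cast; ring
    rw [this, norm_mul, hz, Complex.norm_real, mul_one, Real.norm_eq_abs]
  have hmax' : ∀ᶠ s : ℝ in 𝓝 0, u (z + s * z) + ε * Real.posLog ‖z + s * z‖ + v (z + s * z)
      ≤ u z + ε * Real.posLog ‖z‖ + v z := by
    have : Tendsto (fun s : ℝ => z + (s : ℂ) * z) (𝓝 0) (𝓝 z) := by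
      simpa using (hline 0).continuousAt.tendsto
    exact this.eventually hmax
  have hpos : Real.posLog ‖z‖ = 0 := by simp [hz, Real.posLog]
  rw [hpos] at hmax'
  -- inside the circle the kink term vanishes
  have h1 : 0 ≤ (L + L') z := by
    by_contra hneg
    push Not at hneg
    have h2 := (hasDerivAt_iff_tendsto_slope.1 hW').eventually (gt_mem_nhds hneg)
    have h3 : ∀ᶠ s : ℝ in 𝓝[<] 0, slope (fun s : ℝ => u (z + s * z) + v (z + s * z)) 0 s < 0 :=
      h2.filter_mono (nhdsLT_le_nhdsNE 0)
    have h4 : ∀ᶠ s : ℝ in 𝓝[<] 0, -1 < s :=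
      (lt_mem_nhds (by norm_num)).filter_mono nhdsWithin_le_nhds
    have h5 : ∀ᶠ s : ℝ in 𝓝[<] 0, s < 0 := self_mem_nhdsWithin
    obtain ⟨s, h3, h4, h5, h6⟩ :=
      (h3.and (h4.and (h5.and (hmax'.filter_mono nhdsWithin_le_nhds)))).exists
    have h7 : Real.posLog ‖z + s * z‖ = 0 := by
      rw [hnorm, Real.posLog_eq_zero_iff, abs_abs, abs_le]
      constructor <;> linarith
    rw [h7] at h6
    rw [slope_def_field, div_neg_iff] at h3
    simp at h3
    rcases h3 with h3 | h3 <;> linarith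
  -- outside the circle it has slope `ε`
  have h2 : (L + L') z + ε ≤ 0 := by
    by_contra hneg
    push Not at hneg
    have hlog : HasDerivAt (fun s : ℝ => ε * Real.log (1 + s)) ε 0 := by
      have : HasDerivAt (fun s : ℝ => 1 + s) 1 0 := (hasDerivAt_id 0).const_add 1
      have := (this.log (by norm_num)).const_mul ε
      simpa using this
    have h2 := (hasDerivAt_iff_tendsto_slope.1 (hW'.add hlog)).eventually (lt_mem_nhds hneg)
    have h3 := h2.filter_mono (nhdsGT_le_nhdsNE 0)
    have h5 : ∀ᶠ s : ℝ in 𝓝[>] 0, 0 < s := self_mem_nhdsWithin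
    obtain ⟨s, h3, h5, h6⟩ :=
      (h3.and (h5.and (hmax'.filter_mono nhdsWithin_le_nhds))).exists
    have h7 : Real.posLog ‖z + s * z‖ = Real.log (1 + s) := by
      rw [hnorm, abs_of_pos (by linarith), Real.posLog_eq_log]
      rw [abs_of_pos] <;> linarith
    rw [h7] at h6
    rw [slope_def_field, lt_div_iff₀ (by linarith)] at h3
    simp at h3
    linarith
  linarith

/-- **Liouville's theorem** for a function glued along the unit circle: `u` is bounded above and
satisfies the asymptotic sub-mean value inequality off the circle, while it is differentiable at
the points of the circle. A kink `ε log⁺ |z|` prevents local maxima on the circle, so no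
subharmonicity there is needed. -/
theorem eq_of_asymSubMeanAt_or_differentiableAt {u : ℂ → ℝ} (hc : Continuous u) {B : ℝ}
    (hB : ∀ z, u z ≤ B)
    (h : ∀ z, AsymSubMeanAt u z ∨ (‖z‖ = 1 ∧ DifferentiableAt ℝ u z)) (z a : ℂ) : u z = u a := by
  -- it is enough to bound `u z` by `u a`, which is done by comparing with `u` near `a`
  suffices H : ∀ z a : ℂ, u z ≤ u a from le_antisymm (H z a) (H a z)
  clear z a
  intro z a
  refine le_of_forall_pos_le_add fun η hη => ?_
  by_cases hza : z = a
  · rw [hza]; linarith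
  obtain ⟨r₀, hr₀, hr₀u⟩ := Metric.continuousAt_iff.1 hc.continuousAt η hη
  obtain ⟨r, hr, hr1⟩ : ∃ r, 0 < r ∧ r < min r₀ ‖z - a‖ :=
    exists_between (lt_min hr₀ (norm_pos_iff.2 (sub_ne_zero.2 hza)))
  have hrr₀ : r < r₀ := lt_of_lt_of_le hr1 (min_le_left _ _)
  have hrz : r < ‖z - a‖ := lt_of_lt_of_le hr1 (min_le_right _ _)
  have hS : ∀ y, ‖y - a‖ = r → u y ≤ u a + η := by
    intro y hy
    have := hr₀u (x := y) (by rw [dist_eq_norm, hy]; exact hrr₀)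
    rw [Real.dist_eq] at this
    linarith [(abs_lt.1 this).2]
  -- the estimate with the perturbation
  have key : ∀ ε > 0, u z ≤ u a + η + ε * (Real.posLog (‖a‖ + r) + 2 * Real.log (‖z - a‖) -
      2 * Real.log r) := by
    intro ε hε
    set U : ℂ → ℝ := fun y => u y + ε * Real.posLog ‖y‖ + (-(2 * ε)) * Real.log ‖y - a‖ with hU
    -- a radius beyond which the logarithm dominates
    obtain ⟨R, hRz, hRa, hR⟩ : ∃ R, ‖z - a‖ < R ∧ 1 + ‖a‖ < R ∧
        B + ε * (Real.log 2 + Real.log R) - 2 * ε * Real.log R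
          ≤ u a + η + ε * Real.posLog (‖a‖ + r) - 2 * ε * Real.log r := by
      have h1 : Tendsto (fun R => ε * Real.log R) atTop atTop :=
        Tendsto.const_mul_atTop hε Real.tendsto_log_atTop
      obtain ⟨R, h1, h2, h3⟩ := ((h1.eventually_ge_atTop (B + ε * Real.log 2 -
        (u a + η + ε * Real.posLog (‖a‖ + r) - 2 * ε * Real.log r))).and
        ((eventually_gt_atTop ‖z - a‖).and (eventually_gt_atTop (1 + ‖a‖)))).exists
      exact ⟨R, h2, h3, by linarith⟩
    have hR0 : 0 < R := lt_trans hr (hrz.trans hRz)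
    set K : Set ℂ := closedBall a R ∩ {y | r ≤ ‖y - a‖}
    have hK : IsCompact K := (isCompact_closedBall a R).inter_right
      (isClosed_le continuous_const (by fun_prop))
    have hne : ∀ y ∈ K, y - a ≠ 0 := by
      intro y hy h0
      have : r ≤ ‖y - a‖ := hy.2
      rw [h0, norm_zero] at this
      linarith
    have hUc : ∀ y, y - a ≠ 0 → ContinuousAt U y := by
      intro y hy
      have h1 : ContinuousAt (fun y => Real.log ‖y - a‖) y :=
        ContinuousAt.log (by fun_prop) (by simpa using hy)
      have h2 : ContinuousAt (fun y : ℂ => Real.posLog ‖y‖) y :=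
        (Real.continuous_posLog.comp continuous_norm).continuousAt
      exact (hc.continuousAt.add (h2.const_mul ε)).add (h1.const_mul _)
    have hmain := le_of_no_isLocalMax (U := U) (K := K) hK
      (fun y hy => (hUc y (hne y hy)).continuousWithinAt)
      (m := u a + η + ε * Real.posLog (‖a‖ + r) - 2 * ε * Real.log r) ?_ z
      ⟨by rw [mem_closedBall, dist_eq_norm]; exact hRz.le, hrz.le⟩
    · have := Real.posLog_nonneg (x := ‖z‖)
      have h4 : 0 ≤ ε * Real.posLog ‖z‖ := by positivity
      simp only [hU] at hmain
      nlinarith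
    intro y hy
    rcases eq_or_lt_of_le (show r ≤ ‖y - a‖ from hy.2) with hyr | hyr
    · -- the inner circle
      left
      have h1 := hS y hyr.symm
      have h2 : Real.posLog ‖y‖ ≤ Real.posLog (‖a‖ + r) := by
        refine Real.posLog_le_posLog (norm_nonneg _) ?_
        have := norm_add_le a (y - a)
        rw [add_sub_cancel, ← hyr] at this
        exact this
      simp only [hU, ← hyr]
      nlinarith
    have hyR' : ‖y - a‖ ≤ R := by simpa [dist_eq_norm] using hy.1
    rcases eq_or_lt_of_le hyR' with hyR | hyR
    · -- the outer circle
      left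
      have h2 : Real.posLog ‖y‖ ≤ Real.log 2 + Real.log R := by
        rw [← Real.log_mul (by norm_num) hR0.ne']
        have h3 : ‖y‖ ≤ 2 * R := by
          have := norm_add_le a (y - a)
          rw [add_sub_cancel] at this
          linarith
        have h4 := Real.posLog_le_posLog (norm_nonneg _) h3
        rw [Real.posLog_eq_log (x := 2 * R)] at h4
        · exact h4
        · rw [abs_of_pos (by positivity)]
          linarith [norm_nonneg a]
      have h5 := hB y
      simp only [hU, hyR]
      nlinarith
    -- interior points
    right
    have hya : y ≠ a := sub_ne_zero.1 (hne y hy)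
    have hopen : IsOpen {y : ℂ | r < ‖y - a‖ ∧ ‖y - a‖ < R} :=
      isOpen_Ioo.preimage (f := fun y : ℂ => ‖y - a‖) (by fun_prop)
    refine ⟨mem_of_superset (hopen.mem_nhds ⟨hyr, hyR⟩) fun w hw =>
      ⟨by rw [mem_closedBall, dist_eq_norm]; exact hw.2.le, hw.1.le⟩, fun δ hδ => ?_⟩
    have hlogc : ∀ᶠ w in 𝓝 y, ContinuousAt (fun y => (-(2 * ε)) * Real.log ‖y - a‖) w := by
      filter_upwards [isOpen_ne.mem_nhds hya] with w hw
      exact ((ContinuousAt.log (by fun_prop) (by simpa [sub_eq_zero] using hw))).const_mul _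
    by_cases hy1 : ‖y‖ = 1
    · rcases h y with hu | ⟨-, hu⟩
      · -- the kink term is bounded below by its value `0` on the circle
        refine AsymSubMeanAt.not_isLocalMax ?_ ?_ hδ
        · refine AsymSubMeanAt.add (hu.add (asymSubMeanAt_of_eventually ?_) ?_ ?_)
            (asymSubMeanAt_log _ hya) ?_ hlogc
          · refine Eventually.of_forall fun t => ?_
            have hp : Continuous fun ζ : ℂ => ε * Real.posLog ‖y + t * ζ‖ := by fun_prop
            refine le_avg hp.continuousOn fun ζ _ => ?_
            rw [hy1, Real.posLog_one, mul_zero]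
            exact mul_nonneg hε.le Real.posLog_nonneg
          · exact Eventually.of_forall fun w => hc.continuousAt
          · exact Eventually.of_forall fun w => Continuous.continuousAt (by fun_prop)
          · exact Eventually.of_forall fun w => Continuous.continuousAt (by fun_prop)
        · filter_upwards [isOpen_ne.mem_nhds hya] with w hw
          exact hUc w (sub_ne_zero.2 hw)
      · have hlog : DifferentiableAt ℝ
            (fun y => (-(2 * ε)) * Real.log ‖y - a‖ + δ * ‖y‖ ^ 2) y := by
          have h1 : DifferentiableAt ℝ (fun y => ‖y - a‖) y :=
            ((contDiffAt_norm ℝ (sub_ne_zero.2 hya)).differentiableAt one_ne_zero).comp y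
              (by fun_prop)
          have h2 : DifferentiableAt ℝ (fun y : ℂ => ‖y‖ ^ 2) y :=
            (contDiff_norm_sq ℝ (n := 1)).differentiable one_ne_zero y
          exact ((h1.log (by simpa [sub_eq_zero] using hya)).const_mul _).add (h2.const_mul δ)
        have := not_isLocalMax_of_kink hy1 hu.hasFDerivAt hε hlog.hasFDerivAt
        simpa only [hU, add_assoc] using this
    · have hu : AsymSubMeanAt u y := (h y).resolve_right fun h => hy1 h.1
      refine AsymSubMeanAt.not_isLocalMax ?_ ?_ hδ
      · refine AsymSubMeanAt.add (hu.add ?_ ?_ ?_) (asymSubMeanAt_log _ hya) ?_ hlogc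
        · rcases lt_or_gt_of_ne hy1 with hy1 | hy1
          · refine asymSubMeanAt_of_eventually (Eventually.of_forall fun t => ?_)
            have hp : Continuous fun ζ : ℂ => ε * Real.posLog ‖y + t * ζ‖ := by fun_prop
            refine le_avg hp.continuousOn fun ζ _ => ?_
            have : Real.posLog ‖y‖ = 0 := by
              rw [Real.posLog_eq_zero_iff, abs_norm]; exact hy1.le
            rw [this, mul_zero]
            exact mul_nonneg hε.le Real.posLog_nonneg
          · have hy0 : y ≠ 0 := by rintro rfl; simp at hy1; linarith
            intro δ' hδ'
            filter_upwards [asymSubMeanAt_log ε (p := 0) hy0 δ' hδ', eventually_circle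
              ((isOpen_lt continuous_const continuous_norm).mem_nhds hy1)] with t ht ht1
            have h1 : ∀ w : ℂ, 1 < ‖w‖ → Real.posLog ‖w‖ = Real.log ‖w - 0‖ := fun w hw => by
              rw [sub_zero, Real.posLog_eq_log (by rw [abs_norm]; exact hw.le)]
            rw [h1 y hy1]
            refine ht.trans_eq ?_
            congr 1
            exact avg_congr fun ζ hζ => by rw [h1 _ (ht1 ζ hζ.le)]
        · exact Eventually.of_forall fun w => hc.continuousAt
        · exact Eventually.of_forall fun w => Continuous.continuousAt (by fun_prop)
        · exact Eventually.of_forall fun w => Continuous.continuousAt (by fun_prop)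
      · filter_upwards [isOpen_ne.mem_nhds hya] with w hw
        exact hUc w (sub_ne_zero.2 hw)
  set Cst := Real.posLog (‖a‖ + r) + 2 * Real.log (‖z - a‖) - 2 * Real.log r
  have hlim : Tendsto (fun ε : ℝ => u a + η + ε * Cst) (𝓝[>] 0) (𝓝 (u a + η)) := by
    have : Continuous fun ε : ℝ => u a + η + ε * Cst := by fun_prop
    have h2 := this.tendsto 0
    rw [zero_mul, add_zero] at h2
    exact h2.mono_left nhdsWithin_le_nhds
  exact ge_of_tendsto hlim (by filter_upwards [self_mem_nhdsWithin] with ε hε using key ε hε)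

/-! ### Functions with vanishing first moments -/

/-- The first moments of the real part of an entire function are given by its derivative. -/
theorem avg_re_mul_re {q : ℂ → ℂ} (hq : Differentiable ℂ q) (α : ℂ) :
    circleAverage (fun ζ : ℂ => (q ζ).re * (α * ζ).re) 0 1
      = (starRingEnd ℂ α * deriv q 0).re / 2 := by
  have hd : Differentiable ℂ (dslope q 0) := by
    rw [← differentiableOn_univ] at hq ⊢
    exact (Complex.differentiableOn_dslope univ_mem).2 hq
  have hcq := hq.continuous
  have hcd := hd.continuous
  have h1 : ∀ ζ : ℂ, ‖ζ‖ = 1 → (q ζ).re * (α * ζ).re =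
      1 / 2 * ((q ζ * (α * ζ) + starRingEnd ℂ (starRingEnd ℂ α * q 0) * ζ).re
        + (starRingEnd ℂ α * dslope q 0 ζ).re) := by
    intro ζ hζ
    have h2 : ζ * starRingEnd ℂ ζ = 1 := by rw [Complex.mul_conj']; simp [hζ]
    have h3 : q ζ = q 0 + ζ * dslope q 0 ζ := by
      have := sub_smul_dslope q 0 ζ
      rw [sub_zero, smul_eq_mul] at this
      rw [this]; ring
    have h4 : starRingEnd ℂ α * dslope q 0 ζ
        = starRingEnd ℂ α * starRingEnd ℂ ζ * (q ζ - q 0) := by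
      rw [h3]
      linear_combination (-(starRingEnd ℂ α * dslope q 0 ζ)) * h2
    rw [h4]
    simp
    ring
  rw [avg_congr h1, avg_const_mul, avg_add (by fun_prop) (by fun_prop),
    avg_re_of_differentiable (p := fun ζ => q ζ * (α * ζ) +
      starRingEnd ℂ (starRingEnd ℂ α * q 0) * ζ) (by fun_prop),
    avg_re_of_differentiable (p := fun ζ => starRingEnd ℂ α * dslope q 0 ζ) (by fun_prop)]
  simp
  ring

/-- A continuous function on the plane with the mean value property and with vanishing first
moments on all circles of radius `1` is constant: it is close to the real part of an entire
function, whose derivative is given by the first moments. -/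
theorem eq_of_mean_value_of_moment {k : ℂ → ℝ} (hk : Continuous k)
    (hmv : ∀ (z : ℂ) (t : ℝ), circleAverage (fun ζ : ℂ => k (z + t * ζ)) 0 1 = k z)
    (hmo : ∀ z α : ℂ, circleAverage (fun ζ : ℂ => k (z + ζ) * (α * ζ).re) 0 1 = 0) (z : ℂ) :
    k z = k 0 := by
  set S : ℝ := ‖z‖ + 1
  have hS : 0 < S := by positivity
  have hSc : (S : ℂ) ≠ 0 := by exact_mod_cast hS.ne'
  -- an estimate for every degree of approximation
  have key : ∀ ε > 0, |k z - k 0| ≤ ε * (2 + 2 * ‖z‖) := by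
    intro ε hε
    obtain ⟨p, hp, hpk⟩ := exists_entire_re_approx (f := fun ζ => k (S * ζ)) (by fun_prop) hε
    set P : ℂ → ℂ := fun y => p (S⁻¹ * y)
    have hP : Differentiable ℂ P := by fun_prop
    have hpc := hp.continuous
    have hPc := hP.continuous
    have hdisc : ∀ s : ℝ, (s = 1 ∨ s = -1) → ∀ ζ ∈ closedBall (0 : ℂ) 1,
        s * k (S * ζ) + (-(s * p ζ)).re ≤ ε := by
      intro s hs
      refine le_of_asymSubMeanAt_disc (U := fun ζ => s * k (S * ζ) + (-(s * p ζ)).re)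
        (by fun_prop) (fun w _ => ?_) (fun ζ hζ => ?_)
      · refine AsymSubMeanAt.add (asymSubMeanAt_of_eventually (Eventually.of_forall fun t => ?_))
          (asymSubMeanAt_re (p := fun ζ => -(s * p ζ)) (by fun_prop) w)
          (Eventually.of_forall fun y => Continuous.continuousAt (by fun_prop))
          (Eventually.of_forall fun y => Continuous.continuousAt (by fun_prop))
        rw [avg_const_mul, ← hmv (S * w) (S * t)]
        apply le_of_eq
        congr 3
        funext ζ
        congr 1
        push_cast
        ring
      · have h1 := abs_lt.1 (hpk ζ hζ)
        rcases hs with rfl | rfl <;> simp <;> linarith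
    have hclose : ∀ y : ℂ, ‖y‖ ≤ S → |k y - (P y).re| ≤ ε := by
      intro y hy
      have hmem : (S : ℂ)⁻¹ * y ∈ closedBall (0 : ℂ) 1 := by
        rw [mem_closedBall_zero_iff, norm_mul, norm_inv, Complex.norm_real,
          Real.norm_of_nonneg hS.le, inv_mul_le_iff₀ hS, mul_one]
        exact hy
      have e : (S : ℂ) * ((S : ℂ)⁻¹ * y) = y := by field_simp
      have h1 := hdisc 1 (Or.inl rfl) _ hmem
      have h2 := hdisc (-1) (Or.inr rfl) _ hmem
      rw [e] at h1 h2
      simp only [P, Complex.ofReal_inv]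
      simp at h1 h2
      rw [abs_le]
      constructor <;> linarith
    have hder : ∀ y ∈ closedBall (0 : ℂ) ‖z‖, ‖deriv P y‖ ≤ 2 * ε := by
      intro y hy
      rw [mem_closedBall_zero_iff] at hy
      set d := deriv P y
      have h1 := avg_re_mul_re (q := fun ζ => P (y + ζ)) (by fun_prop) d
      rw [deriv_comp_const_add, add_zero, mul_comm, Complex.mul_conj'] at h1
      have h2 : circleAverage (fun ζ : ℂ => (P (y + ζ)).re * (d * ζ).re
          - k (y + ζ) * (d * ζ).re) 0 1 ≤ ε * ‖d‖ := by
        refine avg_le (by fun_prop) (fun ζ hζ => ?_)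
        rw [← sub_mul]
        refine (le_abs_self _).trans ?_
        rw [abs_mul]
        refine mul_le_mul ?_ ?_ (abs_nonneg _) hε.le
        · rw [abs_sub_comm]
          refine hclose _ ((norm_add_le _ _).trans ?_)
          rw [hζ]; simp only [S]; linarith
        · refine (Complex.abs_re_le_norm _).trans ?_
          rw [norm_mul, hζ, mul_one]
      rw [avg_sub (by fun_prop) (by fun_prop), h1, hmo] at h2
      have h3 : ((‖d‖ : ℂ) ^ 2).re = ‖d‖ ^ 2 := by norm_cast
      rw [h3] at h2
      by_contra hcon
      push Not at hcon
      nlinarith [norm_nonneg d]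
    have hlip := (convex_closedBall (0 : ℂ) ‖z‖).norm_image_sub_le_of_norm_deriv_le
      (f := P) (x := 0) (y := z) (fun y _ => hP y) hder (by simp) (by simp)
    rw [sub_zero] at hlip
    have h1 := hclose z (by simp only [S]; linarith)
    have h2 := hclose 0 (by simp only [norm_zero]; exact hS.le)
    have h3 := (Complex.abs_re_le_norm (P z - P 0)).trans hlip
    rw [Complex.sub_re] at h3
    rw [abs_le] at *
    constructor <;> nlinarith
  by_contra hne
  have hpos : 0 < |k z - k 0| := abs_pos.2 (sub_ne_zero.2 hne)
  have h4 : 0 < 2 + 2 * ‖z‖ := by positivity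
  have := key (|k z - k 0| / (2 * (2 + 2 * ‖z‖))) (by positivity)
  rw [div_mul_eq_mul_div, le_div_iff₀ (by positivity)] at this
  nlinarith

/-! ### Local sub-mean value inequalities and plurisubharmonicity -/

section SubMean
variable {E : Type*} [NormedAddCommGroup E] [NormedSpace ℂ E]

/-- The sub-mean value inequality at `a` on all sufficiently small circles in each complex
direction. -/
def LocalSubMeanAt (f : E → ℝ) (a : E) : Prop :=
  ∀ b : E, ∀ᶠ t : ℝ in 𝓝[>] 0,
    f a ≤ circleAverage (fun ζ : ℂ => f (a + ((t : ℂ) * ζ) • b)) 0 1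

theorem eventually_disc {a : E} {p : E → Prop} (h : ∀ᶠ y in 𝓝 a, p y) (b : E) :
    ∀ᶠ t : ℝ in 𝓝[>] 0, ∀ ζ : ℂ, ‖ζ‖ ≤ 1 → p (a + ((t : ℂ) * ζ) • b) := by
  have h1 : Tendsto (fun w : ℂ => a + w • b) (𝓝 0) (𝓝 a) := by
    have : Continuous fun w : ℂ => a + w • b := by fun_prop
    simpa using this.tendsto 0
  simpa using eventually_circle (h1.eventually h)

theorem continuousOn_disc {f : E → ℝ} {a b : E}
    (h : ∀ ζ : ℂ, ‖ζ‖ ≤ 1 → ContinuousAt f (a + ζ • b)) :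
    ContinuousOn (fun ζ : ℂ => f (a + ζ • b)) (closedBall 0 1) := by
  intro ζ hζ
  exact (ContinuousAt.comp (f := fun ζ : ℂ => a + ζ • b) (h ζ (by simpa using hζ))
    (by fun_prop)).continuousWithinAt

theorem continuousOn_small_circle {f : E → ℝ} {a b : E} {t : ℝ}
    (h : ∀ ζ : ℂ, ‖ζ‖ ≤ 1 → ContinuousAt f (a + ((t : ℂ) * ζ) • b)) :
    ContinuousOn (fun ζ : ℂ => f (a + ((t : ℂ) * ζ) • b)) (sphere 0 1) := by
  intro ζ hζ
  exact (ContinuousAt.comp (f := fun ζ : ℂ => a + ((t : ℂ) * ζ) • b)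
    (h ζ (by simpa using (mem_sphere_zero_iff_norm.1 hζ).le)) (by fun_prop)).continuousWithinAt

theorem LocalSubMeanAt.congr {f g : E → ℝ} {a : E} (hf : LocalSubMeanAt f a)
    (h : f =ᶠ[𝓝 a] g) : LocalSubMeanAt g a := by
  intro b
  filter_upwards [hf b, eventually_disc h b] with t ht h1
  rw [← h.eq_of_nhds]
  exact ht.trans_eq (avg_congr fun ζ hζ => h1 ζ hζ.le)

theorem LocalSubMeanAt.add {f g : E → ℝ} {a : E} (hf : LocalSubMeanAt f a)
    (hg : LocalSubMeanAt g a) (hcf : ∀ᶠ y in 𝓝 a, ContinuousAt f y)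
    (hcg : ∀ᶠ y in 𝓝 a, ContinuousAt g y) : LocalSubMeanAt (fun x => f x + g x) a := by
  intro b
  filter_upwards [hf b, hg b, eventually_disc hcf b, eventually_disc hcg b] with t h1 h2 h3 h4
  rw [avg_add (continuousOn_small_circle h3) (continuousOn_small_circle h4)]
  linarith

theorem LocalSubMeanAt.max {f g : E → ℝ} {a : E} (hf : LocalSubMeanAt f a)
    (hg : LocalSubMeanAt g a) (hcf : ∀ᶠ y in 𝓝 a, ContinuousAt f y)
    (hcg : ∀ᶠ y in 𝓝 a, ContinuousAt g y) : LocalSubMeanAt (fun x => Max.max (f x) (g x)) a := by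
  intro b
  filter_upwards [hf b, hg b, eventually_disc hcf b, eventually_disc hcg b] with t h1 h2 h3 h4
  have h5 := continuousOn_small_circle h3
  have h6 := continuousOn_small_circle h4
  exact max_le (h1.trans (avg_mono h5 (h5.sup h6) fun ζ _ => le_max_left _ _))
    (h2.trans (avg_mono h6 (h5.sup h6) fun ζ _ => le_max_right _ _))

theorem LocalSubMeanAt.const_mul {f : E → ℝ} {a : E} (hf : LocalSubMeanAt f a) {s : ℝ}
    (hs : 0 ≤ s) : LocalSubMeanAt (fun x => s * f x) a := by
  intro b
  filter_upwards [hf b] with t h1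
  rw [avg_const_mul]
  gcongr

theorem localSubMeanAt_const (m : ℝ) (a : E) : LocalSubMeanAt (fun _ => m) a := fun _ =>
  Eventually.of_forall fun _ => (avg_const m).ge

theorem localSubMeanAt_of_midpoint {f : E → ℝ} {a : E} (hc : ∀ᶠ y in 𝓝 a, ContinuousAt f y)
    (h : ∀ v, 2 * f a ≤ f (a + v) + f (a - v)) : LocalSubMeanAt f a := by
  intro b
  filter_upwards [eventually_disc hc b] with t h3
  refine le_avg_of_midpoint (continuousOn_small_circle h3) fun ζ _ => ?_
  have := h (((t : ℂ) * ζ) • b)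
  rwa [sub_eq_add_neg, ← neg_smul, ← mul_neg] at this

theorem localSubMeanAt_norm_sq {F : Type*} [NormedAddCommGroup F] [InnerProductSpace ℂ F] (a : F) :
    LocalSubMeanAt (fun x : F => ‖x‖ ^ 2) a := by
  refine localSubMeanAt_of_midpoint (Eventually.of_forall fun y => by fun_prop) fun v => ?_
  have := parallelogram_law_with_norm ℂ a v
  nlinarith [norm_nonneg v]

/-- A function which is continuous and has the local sub-mean value property on an open set
satisfies the sub-mean value inequality on all closed discs in this set. -/
theorem le_avg_of_localSubMeanAt {f : E → ℝ} {U : Set E} (hU : IsOpen U) (hc : ContinuousOn f U)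
    (hf : ∀ a ∈ U, LocalSubMeanAt f a) {a b : E} (hab : ∀ ζ : ℂ, ‖ζ‖ ≤ 1 → a + ζ • b ∈ U) :
    f a ≤ circleAverage (fun ζ : ℂ => f (a + ζ • b)) 0 1 := by
  have h := le_avg_of_asymSubMeanAt (u := fun ζ : ℂ => f (a + ζ • b))
    (continuousOn_disc fun ζ hζ => hc.continuousAt (hU.mem_nhds (hab ζ hζ))) fun z hz => ?_
  · simpa using h
  · refine asymSubMeanAt_of_eventually ?_
    have hz' : ‖z‖ ≤ 1 := by simpa using (mem_ball_zero_iff.1 hz).le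
    filter_upwards [hf _ (hab z hz') b] with t ht
    simpa only [add_smul, add_assoc] using ht

/-- The local sub-mean value property is preserved under locally uniform approximation. -/
theorem localSubMeanAt_of_approx {f : E → ℝ} {a : E} {U : Set E} (hU : IsOpen U) (ha : a ∈ U)
    {F : ℕ → E → ℝ} (hFc : ∀ n, ContinuousOn (F n) U) (hF : ∀ n, ∀ a ∈ U, LocalSubMeanAt (F n) a)
    (hfc : ContinuousOn f U) {V : Set E} (hV : V ∈ 𝓝 a)
    (h : ∀ ε > 0, ∃ n, ∀ y ∈ V, |F n y - f y| ≤ ε) : LocalSubMeanAt f a := by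
  intro b
  have h0 : ∀ᶠ t : ℝ in 𝓝[>] 0, 0 < t := self_mem_nhdsWithin
  filter_upwards [eventually_disc (hU.mem_nhds ha) b, eventually_disc hV b] with t h1 h2
  refine le_of_forall_pos_le_add fun ε hε => ?_
  obtain ⟨n, hn⟩ := h (ε / 2) (half_pos hε)
  have h3 := le_avg_of_localSubMeanAt hU (hFc n) (hF n) (a := a) (b := (t : ℂ) • b)
    (fun ζ hζ => by rw [smul_smul, mul_comm]; exact h1 ζ hζ)
  simp only [smul_smul, mul_comm _ (t : ℂ)] at h3
  have hcF := continuousOn_small_circle (t := t) (b := b)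
    fun ζ hζ => (hFc n).continuousAt (hU.mem_nhds (h1 ζ hζ))
  have hcf := continuousOn_small_circle (t := t) (b := b)
    fun ζ hζ => hfc.continuousAt (hU.mem_nhds (h1 ζ hζ))
  have h4 := avg_mono hcF (hcf.add (continuousOn_const (c := ε / 2))) fun ζ hζ => by
    have := (abs_le.1 (hn _ (h2 ζ hζ.le))).2
    simp only [Pi.add_apply]
    linarith
  have h5 := avg_add hcf (continuousOn_const (c := ε / 2))
  rw [avg_const] at h5
  have h6 := (abs_le.1 (hn a (mem_of_mem_nhds hV))).1
  have h7 := h4.trans_eq h5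
  linarith

end SubMean

section PSH
variable {n : ℕ} {f : EuclideanSpace ℂ (Fin n) → ℝ} {U : Set (EuclideanSpace ℂ (Fin n))}

theorem isPSHOn_of_continuousOn (hU : IsOpen U) (hc : ContinuousOn f U)
    (h : ∀ a b : EuclideanSpace ℂ (Fin n), (∀ ζ : ℂ, ‖ζ‖ ≤ 1 → a + ζ • b ∈ U) →
      f a ≤ circleAverage (fun ζ : ℂ => f (a + ζ • b)) 0 1) : IsPSHOn f U := by
  refine ⟨hc.upperSemicontinuousOn, fun a b hab => ⟨?_, h a b hab⟩⟩
  have := continuousOn_disc (f := f) (a := a) (b := b) fun ζ hζ =>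
    hc.continuousAt (hU.mem_nhds (hab ζ hζ))
  exact (this.mono sphere_subset_closedBall).circleIntegrable zero_le_one

theorem isPSHOn_of_localSubMeanAt (hU : IsOpen U) (hc : ContinuousOn f U)
    (h : ∀ a ∈ U, LocalSubMeanAt f a) : IsPSHOn f U :=
  isPSHOn_of_continuousOn hU hc fun _ _ hab => le_avg_of_localSubMeanAt hU hc h hab

theorem IsPSHOn.localSubMeanAt (hf : IsPSHOn f U) (hU : IsOpen U) {a : EuclideanSpace ℂ (Fin n)}
    (ha : a ∈ U) : LocalSubMeanAt f a := by
  intro b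
  filter_upwards [eventually_disc (hU.mem_nhds ha) b] with t ht
  have h := (hf.2 a ((t : ℂ) • b) fun ζ hζ => by rw [smul_smul, mul_comm]; exact ht ζ hζ).2
  simpa only [smul_smul, mul_comm _ (t : ℂ)] using h

/-- Adding a small smooth function with compact support to a positive multiple of `‖x‖²` keeps
the sub-mean value property. -/
theorem exists_localSubMeanAt_add {θ : EuclideanSpace ℂ (Fin n) → ℝ}
    (hθ : ContDiff ℝ (⊤ : ℕ∞) θ) (hs : HasCompactSupport θ) {σ : ℝ} (hσ : 0 < σ) :
    ∃ ε₀ : ℝ, 0 < ε₀ ∧ ∀ ε : ℝ, |ε| < ε₀ →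
      ∀ a, LocalSubMeanAt (fun x => σ * ‖x‖ ^ 2 + ε * θ x) a := by
  have hd : ContDiff ℝ 1 (fderiv ℝ θ) := hθ.fderiv_right (by norm_cast)
  obtain ⟨K, hK⟩ := hd.lipschitzWith_of_hasCompactSupport (hs.fderiv ℝ) one_ne_zero
  have hdiff : Differentiable ℝ θ := hθ.differentiable (by simp)
  -- the second difference of `θ` is quadratic
  have hsec : ∀ a v, |θ (a + v) + θ (a - v) - 2 * θ a| ≤ 2 * K * ‖v‖ ^ 2 := by
    intro a v
    have hg : ∀ s ∈ Icc (0 : ℝ) 1, HasDerivWithinAt (fun s : ℝ => θ (a + s • v) + θ (a - s • v))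
        (fderiv ℝ θ (a + s • v) v - fderiv ℝ θ (a - s • v) v) (Icc 0 1) s := by
      intro s _
      have h1 : HasDerivAt (fun s : ℝ => a + s • v) v s := by
        simpa using ((hasDerivAt_id s).smul_const v).const_add a
      have h2 : HasDerivAt (fun s : ℝ => a - s • v) (-v) s := by
        simpa using ((hasDerivAt_id s).smul_const v).const_sub a
      have h3 := (hdiff (a + s • v)).hasFDerivAt.comp_hasDerivAt s h1
      have h4 := (hdiff (a - s • v)).hasFDerivAt.comp_hasDerivAt s h2
      have := h3.add h4
      rw [map_neg, ← sub_eq_add_neg] at this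
      exact this.hasDerivWithinAt
    have := (convex_Icc (0 : ℝ) 1).norm_image_sub_le_of_norm_hasDerivWithin_le hg
      (C := 2 * K * ‖v‖ ^ 2) (fun s hs => ?_) (x := 0) (y := 1) (by simp) (by simp)
    · simp only [one_smul, zero_smul, add_zero, sub_zero, norm_one, mul_one] at this
      rw [Real.norm_eq_abs, ← two_mul] at this
      exact this
    · rw [← sub_apply]
      refine (ContinuousLinearMap.le_opNorm _ _).trans ?_
      have h1 := hK.dist_le_mul (a + s • v) (a - s • v)
      rw [dist_eq_norm, dist_eq_norm] at h1
      have h2 : a + s • v - (a - s • v) = (2 * s) • v := by rw [mul_smul, two_smul]; abel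
      have h3 : ‖a + s • v - (a - s • v)‖ ≤ 2 * ‖v‖ := by
        rw [h2, norm_smul, Real.norm_eq_abs, abs_of_nonneg (by linarith [hs.1])]
        have := hs.2
        gcongr; linarith
      have h4 : ‖fderiv ℝ θ (a + s • v) - fderiv ℝ θ (a - s • v)‖ ≤ K * (2 * ‖v‖) :=
        h1.trans (by gcongr)
      calc _ ≤ K * (2 * ‖v‖) * ‖v‖ := by gcongr
        _ = 2 * K * ‖v‖ ^ 2 := by ring
  refine ⟨σ / (K + 1), by positivity, fun ε hε a => ?_⟩
  refine localSubMeanAt_of_midpoint (Eventually.of_forall fun y => ?_) fun v => ?_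
  · have := hθ.continuous
    fun_prop
  · have h1 := parallelogram_law_with_norm ℂ a v
    have h2 : |ε * (θ (a + v) + θ (a - v) - 2 * θ a)| ≤ 2 * σ * ‖v‖ ^ 2 := by
      rw [abs_mul]
      have h3 : |ε| * (K : ℝ) ≤ σ := by
        rw [lt_div_iff₀ (by positivity)] at hε
        nlinarith [abs_nonneg ε]
      calc |ε| * _ ≤ |ε| * (2 * K * ‖v‖ ^ 2) := by gcongr; exact hsec a v
        _ = 2 * (|ε| * K) * ‖v‖ ^ 2 := by ring
        _ ≤ _ := by gcongr
    have h3 := (abs_le.1 h2).1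
    nlinarith

end PSH

/-! ### Domains with the disc property are pseudoconvex -/

section Disc
variable {E : Type*} [NormedAddCommGroup E] [NormedSpace ℂ E]

/-- The disc property of `U`: an entire curve which maps the unit circle into `U` maps the closed
unit disc into `U`. -/
def HasDiscProperty (U : Set E) : Prop :=
  ∀ D : ℂ → E, Differentiable ℂ D → (∀ ζ : ℂ, ‖ζ‖ = 1 → D ζ ∈ U) → ∀ ζ : ℂ, ‖ζ‖ ≤ 1 → D ζ ∈ U

theorem HasDiscProperty.connectedComponentIn {U : Set E} (hU : HasDiscProperty U) (x₀ : E) :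
    HasDiscProperty (connectedComponentIn U x₀) := by
  intro D hD hC ζ hζ
  have h1 : MapsTo D (closedBall 0 1) U := fun z hz =>
    hU D hD (fun w hw => connectedComponentIn_subset _ _ (hC w hw)) z (by simpa using hz)
  have h2 : IsPreconnected (D '' closedBall 0 1) :=
    (convex_closedBall (0 : ℂ) 1).isPreconnected.image D hD.continuous.continuousOn
  have h3 : D 1 ∈ _root_.connectedComponentIn U x₀ := hC 1 (by simp)
  rw [connectedComponentIn_eq h3]
  exact h2.subset_connectedComponentIn ⟨1, by simp, rfl⟩ h1.image_subset
    ⟨ζ, by simpa using hζ, rfl⟩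

/-- In a domain with the disc property, the function `-log` of the distance to the boundary
satisfies the sub-mean value inequality: if `p` is an entire function whose real part is slightly
larger than it on the circle, then the discs translated by `exp (-p) • c`, with `‖c‖ < 1`, have
their boundary and hence also their centre in the domain. -/
theorem HasDiscProperty.neg_log_infDist_le_avg {U : Set E} (hD : HasDiscProperty U)
    (hU : IsOpen U) (hne : Uᶜ.Nonempty) {a b : E} (hab : ∀ ζ : ℂ, ‖ζ‖ ≤ 1 → a + ζ • b ∈ U) :
    -Real.log (infDist a Uᶜ)
      ≤ circleAverage (fun ζ : ℂ => -Real.log (infDist (a + ζ • b) Uᶜ)) 0 1 := by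
  have hpos : ∀ x ∈ U, 0 < infDist x Uᶜ := fun x hx =>
    (hU.isClosed_compl.notMem_iff_infDist_pos hne).1 (by simpa using hx)
  set f : ℂ → ℝ := fun ζ => -Real.log (infDist (a + ζ • b) Uᶜ)
  have hc : ContinuousOn f (sphere 0 1) := by
    refine (ContinuousOn.log ?_ ?_).neg
    · exact ((continuous_infDist_pt _).comp (by fun_prop)).continuousOn
    · intro ζ hζ
      exact (hpos _ (hab ζ (by simpa using (mem_sphere_zero_iff_norm.1 hζ).le))).ne'
  refine le_of_forall_pos_le_add fun ε hε => ?_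
  obtain ⟨q, hq, hqf⟩ := exists_entire_re_approx hc (half_pos hε)
  set p : ℂ → ℂ := fun ζ => q ζ + (ε / 2 : ℝ)
  have hp : Differentiable ℂ p := by fun_prop
  have hpc := hp.continuous
  have hpf : ∀ ζ : ℂ, ‖ζ‖ = 1 → f ζ < (p ζ).re ∧ (p ζ).re ≤ f ζ + ε := by
    intro ζ hζ
    have := abs_lt.1 (hqf ζ hζ)
    simp only [p, Complex.add_re, Complex.ofReal_re]
    constructor <;> linarith
  have hdist : Real.exp (-(p 0).re) ≤ infDist a Uᶜ := by
    refine (le_infDist hne).2 fun y hy => ?_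
    by_contra hlt
    push Not at hlt
    set c : E := Complex.exp (p 0) • (y - a)
    have hcn : ‖c‖ < 1 := by
      rw [dist_eq_norm, norm_sub_rev] at hlt
      rw [norm_smul, Complex.norm_exp]
      calc Real.exp (p 0).re * ‖y - a‖ < Real.exp (p 0).re * Real.exp (-(p 0).re) := by gcongr
        _ = 1 := by rw [← Real.exp_add]; simp
    have h1 := hD (fun ζ => a + ζ • b + Complex.exp (-p ζ) • c) (by fun_prop) (fun ζ hζ => ?_) 0
      (by simp)
    · apply hy
      simp only [zero_smul, add_zero, c, smul_smul, ← Complex.exp_add] at h1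
      simpa using h1
    · by_contra hmem
      have h2 := infDist_le_dist_of_mem (x := a + ζ • b) (s := Uᶜ) hmem
      rw [dist_eq_norm, sub_add_cancel_left, norm_neg, norm_smul, Complex.norm_exp,
        Complex.neg_re] at h2
      have h3 : Real.exp (-(p ζ).re) < infDist (a + ζ • b) Uᶜ := by
        rw [← Real.lt_log_iff_exp_lt (hpos _ (hab ζ hζ.le))]
        have := (hpf ζ hζ).1
        simp only [f] at this
        linarith
      nlinarith [Real.exp_pos (-(p ζ).re)]
  have h1 : -Real.log (infDist a Uᶜ) ≤ (p 0).re := by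
    have := (Real.le_log_iff_exp_le (hpos a (by simpa using hab 0 (by simp)))).2 hdist
    linarith
  rw [← avg_re_of_differentiable hp] at h1
  refine h1.trans ((avg_mono (by fun_prop) (hc.add (continuousOn_const (c := ε)))
    fun ζ hζ => (hpf ζ hζ).2).trans_eq ?_)
  have h2 := avg_add hc (continuousOn_const (c := ε))
  rw [avg_const] at h2
  exact h2

end Disc

/-- The maximum of `‖x‖` and of `-log` of the distance to the complement is a continuous
plurisubharmonic exhaustion function. -/
theorem HasDiscProperty.isPseudoconvexDomain {n : ℕ} {U : Set (EuclideanSpace ℂ (Fin n))}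
    (hD : HasDiscProperty U) (hU : IsOpen U) (hc : IsConnected U) (hne : Uᶜ.Nonempty) :
    IsPseudoconvexDomain U := by
  have hpos : ∀ x ∈ U, 0 < infDist x Uᶜ := fun x hx =>
    (hU.isClosed_compl.notMem_iff_infDist_pos hne).1 (by simpa using hx)
  set g : EuclideanSpace ℂ (Fin n) → ℝ := fun x => -Real.log (infDist x Uᶜ)
  have hg : ContinuousOn g U := by
    refine (ContinuousOn.log (continuous_infDist_pt _).continuousOn fun x hx => ?_).neg
    exact (hpos x hx).ne'
  have hu : ContinuousOn (fun x => max ‖x‖ (g x)) U := continuous_norm.continuousOn.sup hg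
  refine ⟨hU, hc, fun x => max ‖x‖ (g x), hu, isPSHOn_of_continuousOn hU hu fun a b hab => ?_,
    fun c => ?_⟩
  · have hd : ContinuousOn (fun ζ : ℂ => g (a + ζ • b)) (sphere 0 1) :=
      (continuousOn_disc fun ζ hζ => hg.continuousAt (hU.mem_nhds (hab ζ hζ))).mono
        sphere_subset_closedBall
    have hn : ContinuousOn (fun ζ : ℂ => ‖a + ζ • b‖) (sphere 0 1) := by fun_prop
    refine max_le ?_ ?_
    · refine le_trans ?_ (avg_mono hn (hn.sup hd) fun ζ _ => le_max_left _ _)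
      refine le_avg_of_midpoint hn fun ζ _ => ?_
      have := norm_add_le (a + ζ • b) (a + (-ζ) • b)
      have h2 : a + ζ • b + (a + (-ζ) • b) = (2 : ℝ) • a := by
        rw [neg_smul, two_smul]; abel
      rw [h2, norm_smul] at this
      simpa using this
    · exact (hD.neg_log_infDist_le_avg hU hne hab).trans
        (avg_mono hd (hn.sup hd) fun ζ _ => le_max_right _ _)
  · have heq : {z | z ∈ U ∧ max ‖z‖ (g z) ≤ c}
        = closedBall 0 c ∩ {z | Real.exp (-c) ≤ infDist z Uᶜ} := by
      ext z
      simp only [mem_ofPred_eq, mem_inter_iff, mem_closedBall_zero_iff, max_le_iff]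
      constructor
      · rintro ⟨hz, h1, h2⟩
        refine ⟨h1, ?_⟩
        rw [← Real.le_log_iff_exp_le (hpos z hz)]
        simp only [g] at h2
        linarith
      · rintro ⟨h1, h2⟩
        have hz0 : 0 < infDist z Uᶜ := lt_of_lt_of_le (Real.exp_pos _) h2
        have hz : z ∈ U := by
          have := (hU.isClosed_compl.notMem_iff_infDist_pos hne).2 hz0
          simpa using this
        refine ⟨hz, h1, ?_⟩
        rw [← Real.le_log_iff_exp_le hz0] at h2
        simp only [g]
        linarith
    rw [heq]
    exact (isCompact_closedBall 0 c).inter_right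
      (isClosed_le continuous_const (continuous_infDist_pt _))

/-! ### Plurisubharmonic functions of class `C¹` along holomorphic curves -/

/-- Along a holomorphic curve `D (z + h) = a + h • b + h² • c h`, a function which is strictly
differentiable at `a` and has the sub-mean value property on complex lines satisfies the
asymptotic sub-mean value inequality, as the second order term of the curve averages out. -/
theorem asymSubMeanAt_comp_curve {E : Type*} [NormedAddCommGroup E] [NormedSpace ℂ E]
    {f : E → ℝ} {a b : E} {L : E →L[ℝ] ℝ} (hL : HasStrictFDerivAt f L a)
    (hf : LocalSubMeanAt f a) (hfc : ∀ᶠ y in 𝓝 a, ContinuousAt f y) {D c : ℂ → E} {z : ℂ}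
    (hD : ∀ᶠ h in 𝓝 0, D (z + h) = a + h • b + h ^ 2 • c h) (hDc : ∀ᶠ y in 𝓝 z, ContinuousAt D y)
    (hc : ContinuousAt c 0) : AsymSubMeanAt (fun ζ => f (D ζ)) z := by
  intro δ hδ
  have hDz : D z = a := by simpa using hD.self_of_nhds
  set M : ℝ := ‖c 0‖ + 1
  have hM : 0 < M := by positivity
  set κ : ℝ := δ / (2 * M)
  set κ' : ℝ := δ / (2 * (‖L‖ + 1))
  have hκ : 0 < κ := by positivity
  have hκ' : 0 < κ' := by positivity
  have hstrict := hL.isLittleO.def hκ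
  have hDcont : ContinuousAt D z := hDc.self_of_nhds
  have hDtend : Tendsto (fun h : ℂ => D (z + h)) (𝓝 0) (𝓝 a) := by
    have h1 : Tendsto (fun h : ℂ => z + h) (𝓝 0) (𝓝 z) := by
      have : Continuous fun h : ℂ => z + h := by fun_prop
      simpa using this.tendsto 0
    have h2 := hDcont.tendsto.comp h1
    rwa [hDz] at h2
  have hltend : Tendsto (fun h : ℂ => a + h • b) (𝓝 0) (𝓝 a) := by
    have : Continuous fun h : ℂ => a + h • b := by fun_prop
    simpa using this.tendsto 0
  have e1 := (hDtend.prodMk_nhds hltend).eventually hstrict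
  have e2 : ∀ᶠ h in 𝓝 (0 : ℂ), ‖c h - c 0‖ < min 1 κ' := by
    have := hc.eventually (ball_mem_nhds _ (lt_min one_pos hκ'))
    simpa [dist_eq_norm] using this
  have e3 : ∀ᶠ y in 𝓝 z, ContinuousAt (fun ζ => f (D ζ)) y := by
    have hfc' : ∀ᶠ y in 𝓝 (D z), ContinuousAt f y := by rwa [hDz]
    filter_upwards [hDc, hDcont.eventually hfc'] with y h1 h2
    exact ContinuousAt.comp h2 h1
  have h0 : ∀ᶠ t : ℝ in 𝓝[>] 0, 0 < t := self_mem_nhdsWithin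
  filter_upwards [h0, eventually_circle (e1.and (e2.and hD)), eventually_circle e3,
    eventually_disc hfc b, hf b] with t ht h1 h2 h3 h4
  simp only [zero_add] at h1
  have hcont1 := continuousOn_small_circle h3
  have hcont2 : ContinuousOn (fun ζ : ℂ => t ^ 2 * L (ζ ^ 2 • c 0)) (sphere 0 1) := by
    have := L.continuous
    fun_prop
  have hpt : ∀ ζ : ℂ, ‖ζ‖ = 1 →
      f (a + ((t : ℂ) * ζ) • b) + t ^ 2 * L (ζ ^ 2 • c 0) - δ * t ^ 2 ≤ f (D (z + t * ζ)) := by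
    intro ζ hζ
    obtain ⟨h5, h6, h7⟩ := h1 ζ hζ.le
    set h : ℂ := t * ζ
    have hdiff : D (z + h) - (a + h • b) = h ^ 2 • c h := by rw [h7]; abel
    have hh : ‖h ^ 2‖ = t ^ 2 := by
      simp only [h]
      rw [norm_pow, norm_mul, hζ, Complex.norm_real, mul_one, Real.norm_of_nonneg ht.le]
    rw [hdiff, norm_smul, hh, Real.norm_eq_abs] at h5
    have h8 : ‖c h‖ ≤ M := by
      have := norm_add_le (c h - c 0) (c 0)
      rw [sub_add_cancel] at this
      have h9 := h6.le.trans (min_le_left _ _)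
      simp only [M]
      linarith
    have h9 : κ * (t ^ 2 * ‖c h‖) ≤ δ / 2 * t ^ 2 := by
      calc κ * (t ^ 2 * ‖c h‖) ≤ κ * (t ^ 2 * M) := by gcongr
        _ = δ / 2 * t ^ 2 := by simp only [κ]; field_simp
    have h10 : L (h ^ 2 • c h) = t ^ 2 * L (ζ ^ 2 • c 0) + L (h ^ 2 • (c h - c 0)) := by
      have h11 : h ^ 2 • c 0 = (t ^ 2 : ℝ) • ζ ^ 2 • c 0 := by
        rw [← Complex.coe_smul, smul_smul]
        simp only [h]
        push_cast
        rw [mul_pow]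
      have h12 : L ((t ^ 2 : ℝ) • ζ ^ 2 • c 0) = t ^ 2 * L (ζ ^ 2 • c 0) := by
        rw [map_smul, smul_eq_mul]
      rw [smul_sub, map_sub, h11, h12]
      ring
    have h12 : |L (h ^ 2 • (c h - c 0))| ≤ δ / 2 * t ^ 2 := by
      have h13 := L.le_opNorm (h ^ 2 • (c h - c 0))
      rw [norm_smul, hh, Real.norm_eq_abs] at h13
      refine h13.trans ?_
      calc ‖L‖ * (t ^ 2 * ‖c h - c 0‖) ≤ (‖L‖ + 1) * (t ^ 2 * κ') := by
            have := h6.le.trans (min_le_right _ _)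
            gcongr
            linarith
        _ = δ / 2 * t ^ 2 := by simp only [κ']; field_simp
    have h14 := (abs_le.1 (h5.trans h9)).1
    have h15 := (abs_le.1 h12).1
    linarith
  have hcont12 := hcont1.add hcont2
  have := avg_mono (hcont12.sub (continuousOn_const (c := δ * t ^ 2))) (continuousOn_circle h2) hpt
  have h5 := avg_sub hcont12 (continuousOn_const (c := δ * t ^ 2))
  have h6 := avg_add hcont1 hcont2
  rw [avg_const_mul, avg_sq, mul_zero, add_zero] at h6
  rw [avg_const] at h5
  have h7 : circleAverage (fun ζ : ℂ => f (a + ((t : ℂ) * ζ) • b)) 0 1 - δ * t ^ 2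
      ≤ circleAverage (fun ζ : ℂ => f (D (z + t * ζ))) 0 1 := by
    refine le_trans (le_of_eq ?_) this
    rw [← h6]
    exact h5.symm
  rw [hDz]
  linarith

/-- The space `ℂⁿ` for `n = m + 2`. -/
abbrev CSpace (m : ℕ) := EuclideanSpace ℂ (Fin (m + 2))

/-! ### Rigidity of `C¹` plurisubharmonic functions along entire leaves -/

section Leaves
variable {m : ℕ}

local notation "e₀" => (EuclideanSpace.single (0 : Fin (_ + 2)) (1 : ℂ))

/-- If two points of `C` have the same first coordinate, which lies in the closure of the first
coordinates of a family of leaves, then a continuous map which is constant on these leaves has the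
same value at both points. -/
theorem eq_of_leaf_eq {Z : Type*} [TopologicalSpace Z] [T2Space Z] {C : Set (CSpace m)}
    (hC : IsOpen C) {p : ℕ → ℂ} (hp : sphere (0 : ℂ) 1 ⊆ closure (range p)) {Φ : CSpace m → Z}
    (hΦ : ContinuousOn Φ C)
    (hleaf : ∀ j (x y : CSpace m), x 0 = p j → y 0 = p j → Φ x = Φ y) {x y : CSpace m}
    (hx : x ∈ C) (hy : y ∈ C) (hx1 : ‖x 0‖ = 1) (hxy : x 0 = y 0) : Φ x = Φ y := by
  have hfreq := mem_closure_iff_frequently.1 (hp (mem_sphere_zero_iff_norm.2 hx1))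
  have ht : ∀ w : CSpace m, w ∈ C → w 0 = x 0 →
      Tendsto (fun z : ℂ => Φ (w + (z - w 0) • e₀)) (𝓝 (x 0)) (𝓝 (Φ w)) := by
    intro w hw hwx
    have h1 : Tendsto (fun z : ℂ => w + (z - w 0) • e₀) (𝓝 (x 0)) (𝓝 w) := by
      have : Continuous fun z : ℂ => w + (z - w 0) • e₀ := by fun_prop
      simpa [hwx] using this.tendsto (x 0)
    exact (hΦ.continuousAt (hC.mem_nhds hw)).tendsto.comp h1
  refine tendsto_nhds_unique_of_frequently_eq (ht x hx rfl) (ht y hy hxy.symm)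
    (hfreq.mono ?_)
  rintro z ⟨j, rfl⟩
  exact hleaf j _ _ (by simp) (by simp)

variable {C : Set (CSpace m)} {p : ℕ → ℂ} {φ : CSpace m → ℝ} {B : ℝ}

theorem eq_on_leaf (hC : IsOpen C) (hφ : IsPSHOn φ C) (hφc : ContinuousOn φ C)
    (hB : ∀ x ∈ C, φ x ≤ B) (hleaf : ∀ j (x : CSpace m), x 0 = p j → x ∈ C) (j : ℕ) (x y : CSpace m)
    (hx : x 0 = p j) (hy : y 0 = p j) : φ x = φ y := by
  have hmem : ∀ ζ : ℂ, x + ζ • (y - x) ∈ C := fun ζ => hleaf j _ (by simp [hx, hy])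
  have := eq_of_asymSubMeanAt_or_differentiableAt (u := fun ζ : ℂ => φ (x + ζ • (y - x)))
    (hφc.comp_continuous (by fun_prop) hmem) (fun ζ => hB _ (hmem ζ)) (fun z => Or.inl ?_) 0 1
  · simpa using this
  · refine asymSubMeanAt_of_eventually ?_
    filter_upwards [hφ.localSubMeanAt hC (hmem z) (y - x)] with t ht
    simpa only [add_smul, add_assoc] using ht

/-- The first variation of the sub-mean value inequality at discs contained in a leaf. As these
inequalities are equalities on the leaf, their first variations are equalities, too. -/
theorem avg_fderiv_leaf (hC : IsOpen C) (hφ : IsPSHOn φ C) (hφ1 : ContDiffOn ℝ 1 φ C)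
    (hB : ∀ x ∈ C, φ x ≤ B) (hleaf : ∀ j (x : CSpace m), x 0 = p j → x ∈ C) (j : ℕ) (x v : CSpace m)
    (hx : x 0 = p j) (hv : v 0 = 0) (α β : ℂ) :
    circleAverage (fun ζ : ℂ => fderiv ℝ φ (x + ζ • v) ((β + α * ζ) • e₀)) 0 1
      = fderiv ℝ φ x (β • e₀) := by
  have hdiff : ∀ y ∈ C, DifferentiableAt ℝ φ y := fun y hy =>
    (hφ1.differentiableOn one_ne_zero).differentiableAt (hC.mem_nhds hy)
  have hfd : ContinuousOn (fderiv ℝ φ) C := hφ1.continuousOn_fderiv_of_isOpen hC le_rfl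
  set Γ : ℝ × ℂ → CSpace m := fun q => x + q.2 • v + (q.1 : ℂ) • (β + α * q.2) • e₀ with hΓ
  have hΓc : Continuous Γ := by fun_prop
  have hΓ0 : ∀ ζ, Γ (0, ζ) ∈ C := fun ζ => hleaf j _ (by simp [hΓ, hx, hv])
  obtain ⟨r, hr, hrC⟩ : ∃ r > 0, ∀ s : ℝ, |s| ≤ r → ∀ ζ : ℂ, ‖ζ‖ ≤ 1 → Γ (s, ζ) ∈ C := by
    have h1 : ∀ᶠ s : ℝ in 𝓝 0, ∀ ζ ∈ closedBall (0 : ℂ) 1, Γ (s, ζ) ∈ C := by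
      refine (isCompact_closedBall (0 : ℂ) 1).eventually_forall_of_forall_eventually fun ζ _ => ?_
      exact hΓc.continuousAt.eventually (hC.mem_nhds (hΓ0 ζ))
    obtain ⟨r, hr, h2⟩ := Metric.eventually_nhds_iff.1 h1
    refine ⟨r / 2, by positivity, fun s hs ζ hζ => h2 ?_ ζ (by simpa using hζ)⟩
    rw [Real.dist_eq, sub_zero]
    linarith
  set G : ℝ × ℂ → ℝ := fun q => fderiv ℝ φ (Γ q) ((β + α * q.2) • e₀)
  have hGc : ContinuousOn G (closedBall 0 r ×ˢ closedBall 0 1) := by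
    refine ContinuousOn.clm_apply (hfd.comp hΓc.continuousOn ?_) (by fun_prop)
    rintro ⟨s, ζ⟩ ⟨hs, hζ⟩
    exact hrC s (by simpa using hs) ζ (by simpa using hζ)
  obtain ⟨M, hM⟩ := ((isCompact_closedBall (0 : ℝ) r).prod
    (isCompact_closedBall (0 : ℂ) 1)).exists_bound_of_continuousOn hGc
  have hcirc : ∀ θ : ℝ, ‖circleMap 0 1 θ‖ = 1 := fun θ => by simp
  have hderivΓ : ∀ (ζ : ℂ) (s : ℝ), |s| ≤ r → ‖ζ‖ ≤ 1 →
      HasDerivAt (fun s : ℝ => φ (Γ (s, ζ))) (G (s, ζ)) s := by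
    intro ζ s hs hζ
    have h1 : HasDerivAt (fun s : ℝ => Γ (s, ζ)) ((β + α * ζ) • e₀) s := by
      simpa [hΓ] using (((hasDerivAt_id s).ofReal_comp).smul_const ((β + α * ζ) • e₀)).const_add
        (x + ζ • v)
    exact (hdiff _ (hrC s hs ζ hζ)).hasFDerivAt.comp_hasDerivAt s h1
  have hcontθ : ∀ s : ℝ, |s| ≤ r → Continuous fun θ : ℝ => φ (Γ (s, circleMap 0 1 θ)) := by
    intro s hs
    exact hφ1.continuousOn.comp_continuous (by fun_prop) fun θ => hrC s hs _ (hcirc θ).le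
  have hint := (intervalIntegral.hasDerivAt_integral_of_dominated_loc_of_deriv_le
    (F := fun (s : ℝ) (θ : ℝ) => φ (Γ (s, circleMap 0 1 θ)))
    (F' := fun (s : ℝ) (θ : ℝ) => G (s, circleMap 0 1 θ)) (x₀ := (0 : ℝ)) (s := ball 0 r)
    (a := 0) (b := 2 * Real.pi) (bound := fun _ => M) (μ := MeasureTheory.volume)
    (ball_mem_nhds _ hr) ?_ ?_ ?_ ?_ ?_ ?_).2
  rotate_left
  · filter_upwards [ball_mem_nhds (0 : ℝ) hr] with s hs
    exact (hcontθ s (by simpa using (mem_ball_zero_iff.1 hs).le)).aestronglyMeasurable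
  · exact (hcontθ 0 (by simpa using hr.le)).intervalIntegrable _ _
  · refine Continuous.aestronglyMeasurable ?_
    refine hGc.comp_continuous (by fun_prop) fun θ => ⟨by simpa using hr.le, by simp⟩
  · refine Eventually.of_forall fun θ _ s hs => hM _ ⟨ball_subset_closedBall hs, by simp⟩
  · exact intervalIntegrable_const
  · refine Eventually.of_forall fun θ _ s hs => hderivΓ _ s ?_ (hcirc θ).le
    simpa using (mem_ball_zero_iff.1 hs).le
  have havg : HasDerivAt (fun s : ℝ => circleAverage (fun ζ => φ (Γ (s, ζ))) 0 1)
      (circleAverage (fun ζ => G (0, ζ)) 0 1) 0 := by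
    exact hint.const_smul (2 * Real.pi)⁻¹
  have hmin : IsLocalMin (fun s : ℝ => circleAverage (fun ζ => φ (Γ (s, ζ))) 0 1
      - φ (Γ (s, 0))) 0 := by
    have h0 : circleAverage (fun ζ => φ (Γ (0, ζ))) 0 1 = φ (Γ (0, 0)) := by
      rw [← avg_const (φ (Γ (0, 0)))]
      refine avg_congr fun ζ _ => ?_
      exact eq_on_leaf hC hφ hφ1.continuousOn hB hleaf j _ _ (by simp [hΓ, hx, hv])
        (by simp [hΓ, hx])
    filter_upwards [ball_mem_nhds (0 : ℝ) hr] with s hs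
    rw [h0, sub_self, sub_nonneg]
    have hs' : |s| ≤ r := by simpa using (mem_ball_zero_iff.1 hs).le
    have heq : ∀ ζ : ℂ, Γ (s, ζ) = Γ (s, 0) + ζ • (v + (s : ℂ) • α • e₀) := by
      intro ζ
      simp only [hΓ]
      module
    have := (hφ.2 (Γ (s, 0)) (v + (s : ℂ) • α • e₀)
      fun ζ hζ => by rw [← heq]; exact hrC s hs' ζ hζ).2
    simpa only [← heq] using this
  have h1 := hmin.hasDerivAt_eq_zero (havg.sub (hderivΓ 0 0 (by simpa using hr.le) (by simp)))
  simpa [G, hΓ, sub_eq_zero] using h1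

theorem mul_smul_eq_re_add_im {E : Type*} [NormedAddCommGroup E] [NormedSpace ℂ E] (q s : ℂ)
    (v : E) : (q * s) • v = s.re • q • v + s.im • (Complex.I * q) • v := by
  rw [← Complex.coe_smul, ← Complex.coe_smul, smul_smul, smul_smul, ← add_smul]
  congr 1
  conv_lhs => rw [← Complex.re_add_im s]
  ring

theorem map_mul_smul {E : Type*} [NormedAddCommGroup E] [NormedSpace ℂ E] (L : E →L[ℝ] ℝ)
    (q s : ℂ) (v : E) :
    L ((q * s) • v) = s.re * L (q • v) + s.im * L ((Complex.I * q) • v) := by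
  rw [mul_smul_eq_re_add_im, map_add, L.map_smul_of_tower s.re, L.map_smul_of_tower s.im,
    smul_eq_mul, smul_eq_mul]

/-- The differential of a bounded plurisubharmonic function of class `C¹` is constant along each
leaf, provided the leaves accumulate at all points of the unit circle: its restriction to the leaf
vanishes, the derivative tangential to the circle is the same at all points of the leaf since the
function itself depends only on the first coordinate over the circle, and the normal derivative
`k` is harmonic along with the products of `k` with linear functions. -/
theorem fderiv_eq_on_leaf (hC : IsOpen C) (hφ : IsPSHOn φ C) (hφ1 : ContDiffOn ℝ 1 φ C)
    (hB : ∀ x ∈ C, φ x ≤ B) (hleaf : ∀ j (x : CSpace m), x 0 = p j → x ∈ C)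
    (hp1 : ∀ j, ‖p j‖ = 1) (hp : sphere (0 : ℂ) 1 ⊆ closure (range p)) (j : ℕ) (x y : CSpace m)
    (hx : x 0 = p j) (hy : y 0 = p j) : fderiv ℝ φ x = fderiv ℝ φ y := by
  have hdiff : ∀ y ∈ C, DifferentiableAt ℝ φ y := fun y hy =>
    (hφ1.differentiableOn one_ne_zero).differentiableAt (hC.mem_nhds hy)
  have hfd : ContinuousOn (fderiv ℝ φ) C := hφ1.continuousOn_fderiv_of_isOpen hC le_rfl
  have hpj : p j ≠ 0 := fun h => by simpa [h] using hp1 j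
  have hφleaf := eq_on_leaf hC hφ hφ1.continuousOn hB hleaf
  -- directions tangential to the leaf
  have hvert : ∀ x w : CSpace m, x 0 = p j → w 0 = 0 → fderiv ℝ φ x w = 0 := by
    intro x w hx hw
    have h1 : HasDerivAt (fun s : ℝ => x + s • w) w 0 := by
      simpa using ((hasDerivAt_id (0 : ℝ)).smul_const w).const_add x
    have h0 : HasFDerivAt φ (fderiv ℝ φ x) (x + (0 : ℝ) • w) := by
      simpa using (hdiff x (hleaf j x hx)).hasFDerivAt
    have h2 := h0.comp_hasDerivAt (0 : ℝ) h1
    have h3 : φ ∘ (fun s : ℝ => x + s • w) = fun _ => φ x :=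
      funext fun s => hφleaf j _ _ (by simp [hx, hw]) hx
    rw [h3] at h2
    exact h2.unique (hasDerivAt_const _ _)
  -- the direction tangential to the circle
  have htan : ∀ x y : CSpace m, x 0 = p j → y 0 = p j →
      fderiv ℝ φ x ((Complex.I * p j) • e₀) = fderiv ℝ φ y ((Complex.I * p j) • e₀) := by
    set γ : ℝ → ℂ := fun t => Complex.exp (t * Complex.I) * p j - p j
    have hγ : HasDerivAt γ (Complex.I * p j) 0 := by
      have h1 : HasDerivAt (fun t : ℝ => (t : ℂ) * Complex.I) Complex.I 0 := by
        simpa using ((hasDerivAt_id (0 : ℝ)).ofReal_comp).mul_const Complex.I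
      have h2 := (h1.cexp.mul_const (p j)).sub_const (p j)
      simpa [γ] using h2
    have hγ0 : γ 0 = 0 := by simp [γ]
    have hcurve : ∀ x : CSpace m,
        HasDerivAt (fun t : ℝ => x + γ t • e₀) ((Complex.I * p j) • e₀) 0 := fun x =>
      (hγ.smul_const e₀).const_add x
    have hder : ∀ x : CSpace m, x 0 = p j → HasDerivAt (fun t : ℝ => φ (x + γ t • e₀))
        (fderiv ℝ φ x ((Complex.I * p j) • e₀)) 0 := by
      intro x hx
      have h0 : HasFDerivAt φ (fderiv ℝ φ x) (x + γ 0 • e₀) := by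
        simpa [hγ0] using (hdiff x (hleaf j x hx)).hasFDerivAt
      exact h0.comp_hasDerivAt (0 : ℝ) (hcurve x)
    have hmem : ∀ x : CSpace m, x 0 = p j → ∀ᶠ t in 𝓝 (0 : ℝ), x + γ t • e₀ ∈ C := by
      intro x hx
      refine (hcurve x).continuousAt.eventually (hC.mem_nhds ?_)
      simpa [hγ0] using hleaf j x hx
    intro x y hx hy
    refine (hder x hx).unique ((hder y hy).congr_of_eventuallyEq ?_)
    filter_upwards [hmem x hx, hmem y hy] with t h1 h2
    refine eq_of_leaf_eq hC hp hφ1.continuousOn hφleaf h1 h2 ?_ (by simp [hx, hy])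
    simp [hx, γ, Complex.norm_exp_ofReal_mul_I, hp1]
  -- the normal direction
  have hnorm : fderiv ℝ φ x (p j • e₀) = fderiv ℝ φ y (p j • e₀) := by
    set v : CSpace m := y - x
    have hv : v 0 = 0 := by simp [v, hx, hy]
    have hL : ∀ z : ℂ, (x + z • v) 0 = p j := fun z => by simp [hx, hv]
    set k : ℂ → ℝ := fun z => fderiv ℝ φ (x + z • v) (p j • e₀)
    have hk : Continuous k := (hfd.comp_continuous (by fun_prop)
      fun z => hleaf j _ (hL z)).clm_apply continuous_const
    have hsplit : ∀ z s : ℂ, fderiv ℝ φ (x + z • v) ((p j * s) • e₀)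
        = k z * s.re + fderiv ℝ φ x ((Complex.I * p j) • e₀) * s.im := by
      intro z s
      rw [map_mul_smul, htan _ x (hL z) hx]
      simp only [k]
      ring
    have key := eq_of_mean_value_of_moment hk (fun z t => ?_) (fun z α => ?_) 1
    · simpa [k, v] using key.symm
    · have := avg_fderiv_leaf hC hφ hφ1 hB hleaf j (x + z • v) ((t : ℂ) • v) (hL z)
        (by simp [hv]) 0 (p j)
      simpa only [zero_mul, add_zero, smul_smul, add_assoc, ← add_smul, mul_comm _ (t : ℂ), k]
        using this
    · have := avg_fderiv_leaf hC hφ hφ1 hB hleaf j (x + z • v) v (hL z) hv (p j * α) 0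
      simp only [zero_add, zero_smul, map_zero, add_assoc, ← add_smul, mul_assoc, hsplit] at this
      rw [avg_add (by fun_prop) (by fun_prop), avg_const_mul] at this
      have him : circleAverage (fun ζ : ℂ => (α * ζ).im) 0 1 = 0 := by
        have h1 := avg_re_of_differentiable (p := fun ζ => -Complex.I * (α * ζ)) (by fun_prop)
        simpa using h1
      rwa [him, mul_zero, add_zero] at this
  have hval : ∀ x : CSpace m, x 0 = p j → ∀ w : CSpace m, fderiv ℝ φ x w
      = (w 0 / p j).re * fderiv ℝ φ x (p j • e₀)
        + (w 0 / p j).im * fderiv ℝ φ x ((Complex.I * p j) • e₀) := by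
    intro x hx w
    have hw : w = (p j * (w 0 / p j)) • e₀ + (w - w 0 • e₀) := by
      rw [mul_div_cancel₀ _ hpj]; abel
    conv_lhs => rw [hw]
    rw [map_add, hvert x (w - w 0 • e₀) hx (by simp), add_zero, map_mul_smul]
  ext w
  rw [hval x hx, hval y hy, htan x y hx hy, hnorm]

end Leaves

section Leaves
local notation "e₀" => (EuclideanSpace.single (0 : Fin (_ + 2)) (1 : ℂ))
local notation "e₁" => (EuclideanSpace.single (1 : Fin (_ + 2)) (1 : ℂ))
variable {m : ℕ} {C : Set (CSpace m)} {p : ℕ → ℂ} {φ : CSpace m → ℝ} {B : ℝ}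

/-- Over the unit circle, the differential vanishes in the directions in which the first coordinate
is fixed. -/
theorem fderiv_eq_zero_of_norm_eq_one (hC : IsOpen C) (hφ : IsPSHOn φ C) (hφ1 : ContDiffOn ℝ 1 φ C)
    (hB : ∀ x ∈ C, φ x ≤ B) (hleaf : ∀ j (x : CSpace m), x 0 = p j → x ∈ C)
    (hp : sphere (0 : ℂ) 1 ⊆ closure (range p)) {x v : CSpace m} (hx : x ∈ C) (hx1 : ‖x 0‖ = 1)
    (hv : v 0 = 0) : fderiv ℝ φ x v = 0 := by
  have hdiff : DifferentiableAt ℝ φ x :=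
    (hφ1.differentiableOn one_ne_zero).differentiableAt (hC.mem_nhds hx)
  have h1 : HasDerivAt (fun s : ℝ => x + s • v) v 0 := by
    simpa using ((hasDerivAt_id (0 : ℝ)).smul_const v).const_add x
  have h0 : HasFDerivAt φ (fderiv ℝ φ x) (x + (0 : ℝ) • v) := by simpa using hdiff.hasFDerivAt
  have h2 := h0.comp_hasDerivAt (0 : ℝ) h1
  refine h2.unique ((hasDerivAt_const (0 : ℝ) (φ x)).congr_of_eventuallyEq ?_)
  have h3 : ∀ᶠ s in 𝓝 (0 : ℝ), x + s • v ∈ C :=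
    h1.continuousAt.eventually (hC.mem_nhds (by simpa using hx))
  filter_upwards [h3] with s hs
  exact eq_of_leaf_eq hC hp hφ1.continuousOn
    (eq_on_leaf hC hφ hφ1.continuousOn hB hleaf) hs hx (by simpa [hv] using hx1) (by simp [hv])

/-- The union of a flat disc and of the exterior part of the curve `ζ ↦ (ζ, ζ⁻¹)` behaves, for
bounded plurisubharmonic functions of class `C¹`, as if it were an entire curve, although the two
pieces do not fit together over the unit circle: there the function and its differential only
depend on the first coordinate. -/
theorem eq_of_disc_of_exterior_curve (hC : IsOpen C) (hφ : IsPSHOn φ C) (hφ1 : ContDiffOn ℝ 1 φ C)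
    (hB : ∀ x ∈ C, φ x ≤ B) (hleaf : ∀ j (x : CSpace m), x 0 = p j → x ∈ C)
    (hp1 : ∀ j, ‖p j‖ = 1) (hp : sphere (0 : ℂ) 1 ⊆ closure (range p)) {w : CSpace m} (hw : w 0 = 0)
    (h1 : ∀ ζ : ℂ, ‖ζ‖ ≤ 1 → ζ • e₀ + w ∈ C)
    (h2 : ∀ ζ : ℂ, 1 ≤ ‖ζ‖ → (ζ • e₀ + ζ⁻¹ • e₁ : CSpace m) ∈ C) {ζ : ℂ} (hζ : ‖ζ‖ ≤ 1) :
    φ (ζ • e₀ + w) = φ ((2 : ℂ) • e₀ + (2 : ℂ)⁻¹ • e₁) := by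
  classical
  have hφc := hφ1.continuousOn
  have hdiff : ∀ y ∈ C, DifferentiableAt ℝ φ y := fun y hy =>
    (hφ1.differentiableOn one_ne_zero).differentiableAt (hC.mem_nhds hy)
  have hfd : ContinuousOn (fderiv ℝ φ) C := hφ1.continuousOn_fderiv_of_isOpen hC le_rfl
  set S : ℂ → CSpace m := fun ζ => ζ • e₀ + w
  set T : ℂ → CSpace m := fun ζ => ζ • e₀ + ζ⁻¹ • e₁
  set u : ℂ → ℝ := fun ζ => if ‖ζ‖ ≤ 1 then φ (S ζ) else φ (T ζ) with hu
  have hS : ∀ z : ℂ, HasFDerivAt S ((ContinuousLinearMap.id ℝ ℂ).smulRight (e₀ : CSpace m)) z :=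
    fun z => (((ContinuousLinearMap.id ℝ ℂ).smulRight (e₀ : CSpace m)).hasFDerivAt).add_const w
  have hT : ∀ z : ℂ, z ≠ 0 → ∃ M : ℂ →L[ℝ] CSpace m, HasFDerivAt T M z ∧
      ∀ h, (M h - h • (e₀ : CSpace m)) 0 = 0 := by
    intro z hz
    have hd : HasDerivAt T ((1 : ℂ) • e₀ + (-(z ^ 2)⁻¹) • e₁) z :=
      ((hasDerivAt_id z).smul_const e₀).add ((hasDerivAt_inv hz).smul_const e₁)
    exact ⟨_, hd.hasFDerivAt.restrictScalars ℝ, fun h => by simp⟩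
  have hval : ∀ z : ℂ, ‖z‖ = 1 → φ (S z) = φ (T z) := fun z hz =>
    eq_of_leaf_eq hC hp hφc (eq_on_leaf hC hφ hφc hB hleaf) (h1 z hz.le) (h2 z hz.ge)
      (by simpa [S, hw] using hz) (by simp [S, T, hw])
  have hT0 : ∀ z : ℂ, 1 ≤ ‖z‖ → z ≠ 0 := by
    rintro z hz rfl
    norm_num at hz
  have hTc : ∀ z : ℂ, z ≠ 0 → ContinuousAt T z := fun z hz => by
    obtain ⟨M, hM, -⟩ := hT z hz
    exact hM.continuousAt
  have hucont : Continuous u := by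
    refine continuous_if_le continuous_norm continuous_const ?_ ?_ hval
    · exact hφc.comp (Continuous.continuousOn (by fun_prop)) h1
    · exact hφc.comp (fun z hz => (hTc z (hT0 z hz)).continuousWithinAt) h2
  have huB : ∀ z, u z ≤ B := by
    intro z
    simp only [hu]
    split_ifs with h
    exacts [hB _ (h1 z h), hB _ (h2 z (not_le.1 h).le)]
  have hloc : ∀ y ∈ C, LocalSubMeanAt φ y := fun y hy => hφ.localSubMeanAt hC hy
  have key := eq_of_asymSubMeanAt_or_differentiableAt hucont huB (fun z => ?_) ζ 2
  · have h3 : ¬ ‖(2 : ℂ)‖ ≤ 1 := by norm_num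
    simpa only [hu, if_pos hζ, if_neg h3] using key
  rcases lt_trichotomy ‖z‖ 1 with hz | hz | hz
  · left
    refine asymSubMeanAt_of_eventually ?_
    have h3 : ∀ᶠ y : ℂ in 𝓝 z, ‖y‖ ≤ 1 :=
      (continuous_norm.continuousAt.eventually_lt continuousAt_const hz).mono fun _ h => h.le
    filter_upwards [hloc _ (h1 z hz.le) e₀, eventually_circle h3] with t ht h4
    simp only [hu, if_pos hz.le]
    refine ht.trans_eq (avg_congr fun ξ hξ => ?_)
    rw [if_pos (h4 ξ hξ.le)]
    congr 1
    simp only [S]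
    module
  · right
    refine ⟨hz, ?_⟩
    obtain ⟨M, hM, hM0⟩ := hT z (hT0 z hz.ge)
    have hS' := (hdiff _ (h1 z hz.le)).hasFDerivAt.comp z (hS z)
    have hT' := (hdiff _ (h2 z hz.ge)).hasFDerivAt.comp z hM
    have hfe : fderiv ℝ φ (S z) = fderiv ℝ φ (T z) :=
      eq_of_leaf_eq hC hp hfd (fderiv_eq_on_leaf hC hφ hφ1 hB hleaf hp1 hp) (h1 z hz.le)
        (h2 z hz.ge) (by simpa [S, hw] using hz) (by simp [S, T, hw])
    have hLe : (fderiv ℝ φ (S z)).comp ((ContinuousLinearMap.id ℝ ℂ).smulRight (e₀ : CSpace m))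
        = (fderiv ℝ φ (T z)).comp M := by
      refine ContinuousLinearMap.ext fun h => ?_
      have h5 := fderiv_eq_zero_of_norm_eq_one hC hφ hφ1 hB hleaf hp (h2 z hz.ge)
        (by simpa using hz) (hM0 h)
      rw [map_sub, sub_eq_zero] at h5
      simp only [ContinuousLinearMap.comp_apply, ContinuousLinearMap.smulRight_apply, hfe]
      exact h5.symm
    rw [hLe] at hS'
    have h6 : HasFDerivWithinAt u ((fderiv ℝ φ (T z)).comp M) {y | ‖y‖ ≤ 1} z :=
      hS'.hasFDerivWithinAt.congr (fun y hy => if_pos hy) (if_pos hz.le)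
    have h7 : HasFDerivWithinAt u ((fderiv ℝ φ (T z)).comp M) {y | 1 ≤ ‖y‖} z := by
      have h8 : ∀ y : ℂ, 1 ≤ ‖y‖ → u y = φ (T y) := by
        intro y hy
        simp only [hu]
        split_ifs with h
        exacts [hval y (le_antisymm h hy), rfl]
      exact hT'.hasFDerivWithinAt.congr h8 (h8 z hz.ge)
    have h9 := h6.union h7
    have h10 : {y : ℂ | ‖y‖ ≤ 1} ∪ {y | 1 ≤ ‖y‖} = univ :=
      eq_univ_of_forall fun y => le_total ‖y‖ 1
    rw [h10, hasFDerivWithinAt_univ] at h9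
    exact h9.differentiableAt
  · left
    have hz0 := hT0 z hz.le
    have hTz := h2 z hz.le
    have hstrict : HasStrictFDerivAt φ (fderiv ℝ φ (T z)) (T z) :=
      (hφ1.contDiffAt (hC.mem_nhds hTz)).hasStrictFDerivAt one_ne_zero
    have hcT : ∀ᶠ y in 𝓝 (T z), ContinuousAt φ y := by
      filter_upwards [hC.mem_nhds hTz] with y hy
      exact hφc.continuousAt (hC.mem_nhds hy)
    have h3 : AsymSubMeanAt (fun ζ => φ (T ζ)) z := by
      refine asymSubMeanAt_comp_curve hstrict (hloc _ hTz) hcT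
        (b := e₀ - (z ^ 2)⁻¹ • e₁) (c := fun h => ((z ^ 2)⁻¹ * (z + h)⁻¹) • e₁) ?_ ?_ ?_
      · have h4 : ∀ᶠ h : ℂ in 𝓝 0, z + h ≠ 0 := by
          refine ContinuousAt.eventually_ne (by fun_prop) ?_
          simpa using hz0
        filter_upwards [h4] with h hh
        have h5 : (z + h)⁻¹ = z⁻¹ - h * (z ^ 2)⁻¹ + h ^ 2 * ((z ^ 2)⁻¹ * (z + h)⁻¹) := by
          field_simp
          ring
        simp only [T]
        conv_lhs => rw [h5]
        module
      · filter_upwards [isOpen_ne.mem_nhds hz0] with y hy using hTc y hy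
      · have h5 : ContinuousAt (fun h : ℂ => (z + h)⁻¹) 0 :=
          ContinuousAt.inv₀ (by fun_prop) (by simpa using hz0)
        exact (continuousAt_const.mul h5).smul continuousAt_const
    have h4 : ∀ᶠ y : ℂ in 𝓝 z, 1 < ‖y‖ :=
      continuousAt_const.eventually_lt continuous_norm.continuousAt hz
    intro δ hδ
    filter_upwards [h3 δ hδ, eventually_circle h4] with t ht h5
    simp only [hu, if_neg (not_le.2 hz)]
    refine ht.trans_eq ?_
    congr 1
    refine avg_congr fun ξ hξ => ?_
    rw [if_neg (not_le.2 (h5 ξ hξ.le))]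

end Leaves

/-! ### Two functions of one variable that agree near a dense subset of the circle -/

section OneVariable

theorem localSubMeanAt_log_norm_sub (s : ℝ) {z p : ℂ} (h : z ≠ p) :
    LocalSubMeanAt (fun z : ℂ => s * Real.log ‖z - p‖) z := by
  intro b
  filter_upwards [eventually_disc (isOpen_ne.mem_nhds h) b] with t ht
  have h1 : ∀ ζ : ℂ, z + ((t : ℂ) * ζ) • b - p = (z - p) + ζ * (t * b) := by
    intro ζ
    rw [smul_eq_mul]
    ring
  simp only [h1]
  rw [avg_const_mul, avg_log_norm fun ζ hζ => ?_]
  rw [← h1]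
  exact sub_ne_zero.2 (ht ζ hζ)

theorem continuous_log_max (p : ℂ) {ρ : ℝ} (hρ : 0 < ρ) :
    Continuous fun z : ℂ => Real.log (max ‖z - p‖ ρ) :=
  Continuous.log (by fun_prop) fun z => (lt_max_of_lt_right hρ).ne'

theorem localSubMeanAt_log_max (p : ℂ) {ρ : ℝ} (hρ : 0 < ρ) (z : ℂ) :
    LocalSubMeanAt (fun z : ℂ => Real.log (max ‖z - p‖ ρ)) z := by
  rcases eq_or_ne z p with rfl | hz
  · refine (localSubMeanAt_const (Real.log ρ) z).congr ?_
    filter_upwards [ball_mem_nhds z hρ] with y hy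
    rw [max_eq_right (by simpa [dist_eq_norm] using (mem_ball.1 hy).le)]
  · have h1 : ∀ᶠ y in 𝓝 z, y ≠ p := isOpen_ne.mem_nhds hz
    have h2 := ((localSubMeanAt_log_norm_sub 1 hz).max (localSubMeanAt_const (Real.log ρ) z) ?_
      (Eventually.of_forall fun _ => continuousAt_const))
    · refine h2.congr ?_
      filter_upwards [h1] with y hy
      have h3 : 0 < ‖y - p‖ := norm_pos_iff.2 (sub_ne_zero.2 hy)
      rw [one_mul]
      rcases le_total ‖y - p‖ ρ with h | h
      · rw [max_eq_right h, max_eq_right (Real.log_le_log h3 h)]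
      · rw [max_eq_left h, max_eq_left (Real.log_le_log hρ h)]
    · filter_upwards [h1] with y hy
      exact ContinuousAt.mul continuousAt_const
        (ContinuousAt.log (by fun_prop) (norm_ne_zero_iff.2 (sub_ne_zero.2 hy)))

/-- `f'` is a small modification of `f`, with at most logarithmic growth of the difference, which
respects subharmonicity and, near the origin, strict subharmonicity. -/
structure IsPerturbation (ε : ℝ) (f f' : ℂ → ℝ) : Prop where
  continuous : Continuous f'
  localSubMeanAt : ∀ a, LocalSubMeanAt f a → LocalSubMeanAt f' a
  localSubMeanAt_sub : ∀ a, ‖a‖ < 1 / 2 → LocalSubMeanAt (fun z => f z - ‖z‖ ^ 2) a →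
    LocalSubMeanAt (fun z => f' z - ‖z‖ ^ 2) a
  le_apply : ∀ z, f z - 2 * ε ≤ f' z
  apply_le : ∀ z, f' z ≤ f z + ε / 2 * Real.log (max 1 ‖z‖)
  apply_le_of_norm_le : ∀ z, ‖z‖ ≤ 8 → f' z ≤ f z

/-- Adding a truncated logarithmic pole at `p` pushes `f` below the constant `κ = f p - ε` near `p`,
so that the maximum with this constant is constant there. The same modification works for all
functions which are close to `κ + ε` near `p`. -/
theorem exists_isPerturbation {p : ℂ} (hp : ‖p‖ = 1) {ε : ℝ} (hε : 0 < ε) {r : ℝ} (hr : 0 < r)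
    (hr4 : r ≤ 1 / 4) (κ : ℝ) :
    ∃ lam : ℂ → ℝ, ∃ ρ : ℝ, 0 < ρ ∧ ρ ≤ r ∧ ∀ f : ℂ → ℝ, Continuous f →
      (∀ z, ‖z - p‖ ≤ r → |f z - (κ + ε)| < ε / 4) →
      IsPerturbation ε f (fun z => if ‖z - p‖ < r then max (f z + lam z) κ else f z + lam z) ∧
      ∀ z, ‖z - p‖ < ρ → max (f z + lam z) κ = κ := by
  set l : ℝ := Real.log (20 / r)
  have hl : Real.log 20 - Real.log r = l := (Real.log_div (by norm_num) hr.ne').symm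
  have hl1 : 1 ≤ l := by
    have h1 : (80 : ℝ) ≤ 20 / r := by
      rw [le_div_iff₀ hr]; linarith
    have h2 : Real.exp 1 ≤ 20 / r := by linarith [Real.exp_one_lt_d9]
    exact (Real.le_log_iff_exp_le (by positivity)).2 h2
  -- `lam` is `-ε / 4` on the circle of radius `r` and `-2 ε` on the disc of radius `ρ`; dividing by
  -- `20` in the logarithm makes it nonpositive for `‖z‖ ≤ 19`
  set η : ℝ := ε / (4 * l)
  have hη : 0 < η := by positivity
  have hηl : η * l = ε / 4 := by
    simp only [η]; field_simp
  have hηε : η ≤ ε / 2 := by nlinarith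
  set ρ : ℝ := 20 * (r / 20) ^ 8
  have hρ : 0 < ρ := by positivity
  have hρr : ρ ≤ r := by
    have h1 : (r / 20) ^ 8 ≤ (r / 20) ^ 1 :=
      pow_le_pow_of_le_one (by positivity) (by linarith) (by norm_num)
    simp only [ρ]
    linarith
  have hlρ : Real.log ρ - Real.log 20 = -(8 * l) := by
    simp only [ρ]
    rw [Real.log_mul (by norm_num) (by positivity), Real.log_pow,
      Real.log_div hr.ne' (by norm_num), ← hl]
    push_cast
    ring
  set lam : ℂ → ℝ := fun z => η * (Real.log (max ‖z - p‖ ρ) + -Real.log 20) with hlam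
  have hlamc : Continuous lam :=
    continuous_const.mul ((continuous_log_max p hρ).add continuous_const)
  have hlams : ∀ z, LocalSubMeanAt lam z := fun z =>
    ((localSubMeanAt_log_max p hρ z).add (localSubMeanAt_const _ z)
      (Eventually.of_forall fun y => (continuous_log_max p hρ).continuousAt)
      (Eventually.of_forall fun y => continuousAt_const)).const_mul hη.le
  -- the values of `lam`
  have hlow : ∀ z, -(2 * ε) ≤ lam z := by
    intro z
    have h1 : Real.log ρ ≤ Real.log (max ‖z - p‖ ρ) := Real.log_le_log hρ (le_max_right _ _)
    have h2 : η * -(8 * l) ≤ lam z := mul_le_mul_of_nonneg_left (by linarith) hη.le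
    linarith
  have hlam0 : ∀ z, ‖z - p‖ ≤ ρ → lam z = -(2 * ε) := by
    intro z hz
    simp only [hlam]
    rw [max_eq_right hz, ← sub_eq_add_neg, hlρ]
    linarith
  have hlamr : ∀ z, ‖z - p‖ = r → lam z = -(ε / 4) := by
    intro z hz
    simp only [hlam]
    rw [max_eq_left (by rw [hz]; exact hρr), hz, ← sub_eq_add_neg, ← neg_sub, hl]
    linarith
  have hnp : ∀ z, ‖z - p‖ ≤ ‖z‖ + 1 := fun z => (norm_sub_le z p).trans (by rw [hp])
  have hneg : ∀ z, ‖z‖ ≤ 8 → lam z ≤ 0 := by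
    intro z hz
    have h1 : Real.log (max ‖z - p‖ ρ) ≤ Real.log 20 :=
      Real.log_le_log (lt_max_of_lt_right hρ)
        (max_le ((hnp z).trans (by linarith)) (by linarith))
    exact mul_nonpos_of_nonneg_of_nonpos hη.le (by linarith)
  have hup : ∀ z, lam z ≤ ε / 2 * Real.log (max 1 ‖z‖) := by
    intro z
    have h0 : 0 ≤ Real.log (max 1 ‖z‖) := Real.log_nonneg (le_max_left _ _)
    have h1 : Real.log (max ‖z - p‖ ρ) ≤ Real.log (20 * max 1 ‖z‖) := by
      refine Real.log_le_log (lt_max_of_lt_right hρ) (max_le ((hnp z).trans ?_) ?_)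
      · linarith [le_max_left 1 ‖z‖, le_max_right 1 ‖z‖]
      · linarith [le_max_left 1 ‖z‖]
    rw [Real.log_mul (by norm_num) (lt_max_of_lt_left one_pos).ne'] at h1
    calc lam z ≤ η * Real.log (max 1 ‖z‖) := mul_le_mul_of_nonneg_left (by linarith) hη.le
      _ ≤ _ := mul_le_mul_of_nonneg_right hηε h0
  refine ⟨lam, ρ, hρ, hρr, fun f hf hfr => ?_⟩
  set f' : ℂ → ℝ := fun z => if ‖z - p‖ < r then max (f z + lam z) κ else f z + lam z with hf'
  have hadd : Continuous fun z => f z + lam z := hf.add hlamc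
  have hin : ∀ a, ‖a - p‖ < r → (fun z => max (f z + lam z) κ) =ᶠ[𝓝 a] f' := by
    intro a ha
    have : ∀ᶠ y in 𝓝 a, ‖y - p‖ < r :=
      ContinuousAt.eventually_lt (by fun_prop) continuousAt_const ha
    filter_upwards [this] with y hy
    simp only [hf', if_pos hy]
  have hout : ∀ a, r ≤ ‖a - p‖ → (fun z => f z + lam z) =ᶠ[𝓝 a] f' := by
    intro a ha
    rcases ha.eq_or_lt with ha | ha
    · have h1 : κ < f a + lam a := by
        rw [hlamr a ha.symm]
        have := (abs_lt.1 (hfr a ha.ge)).1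
        linarith
      have h2 : ∀ᶠ y in 𝓝 a, κ < f y + lam y :=
        continuousAt_const.eventually_lt hadd.continuousAt h1
      filter_upwards [h2] with y hy
      simp only [hf']
      split_ifs
      exacts [(max_eq_left hy.le).symm, rfl]
    · have : ∀ᶠ y in 𝓝 a, r < ‖y - p‖ :=
        ContinuousAt.eventually_lt continuousAt_const (by fun_prop) ha
      filter_upwards [this] with y hy
      simp only [hf', if_neg (not_lt.2 hy.le)]
  have hge : ∀ z, f z + lam z ≤ f' z := by
    intro z
    simp only [hf']
    split_ifs
    exacts [le_max_left _ _, le_rfl]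
  have hle : ∀ z c, f z + lam z ≤ c → f z ≤ c → f' z ≤ c := by
    intro z c h1 h2
    simp only [hf']
    split_ifs with h
    · have := (abs_lt.1 (hfr z h.le)).1
      exact max_le h1 (by linarith)
    · exact h1
  have hev : ∀ {g : ℂ → ℝ} (_ : Continuous g) (a : ℂ), ∀ᶠ y in 𝓝 a, ContinuousAt g y :=
    fun hg a => Eventually.of_forall fun y => hg.continuousAt
  refine ⟨⟨?_, ?_, ?_, ?_, ?_, ?_⟩, ?_⟩
  · refine continuous_iff_continuousAt.2 fun a => ?_
    rcases lt_or_ge ‖a - p‖ r with h | h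
    · exact (ContinuousAt.congr (hadd.max continuous_const).continuousAt (hin a h))
    · exact hadd.continuousAt.congr (hout a h)
  · intro a ha
    have h1 := ha.add (hlams a) (hev hf a) (hev hlamc a)
    rcases lt_or_ge ‖a - p‖ r with h | h
    · exact (h1.max (localSubMeanAt_const κ a) (hev hadd a) (hev continuous_const a)).congr
        (hin a h)
    · exact h1.congr (hout a h)
  · intro a ha hs
    have h1 := hs.add (hlams a) (hev (hf.sub (by fun_prop)) a) (hev hlamc a)
    have h2 : r ≤ ‖a - p‖ := by
      have := norm_sub_norm_le p a
      rw [norm_sub_rev, hp] at this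
      linarith
    refine h1.congr ?_
    filter_upwards [hout a h2] with y hy
    rw [← hy]
    ring
  · intro z
    linarith [hge z, hlow z]
  · intro z
    have h0 : 0 ≤ Real.log (max 1 ‖z‖) := Real.log_nonneg (le_max_left _ _)
    refine hle z _ (by linarith [hup z]) ?_
    have : 0 ≤ ε / 2 * Real.log (max 1 ‖z‖) := by positivity
    linarith
  · intro z hz
    exact hle z _ (by linarith [hneg z hz]) le_rfl
  · intro z hz
    refine max_eq_right ?_
    rw [hlam0 z hz.le]
    have := (abs_lt.1 (hfr z (hz.le.trans hρr))).2
    linarith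

/-- Two functions which agree at `p` have small modifications which agree near `p`; the
modifications also agree wherever the given functions do. -/
theorem exists_isPerturbation_pair {p : ℂ} (hp : ‖p‖ = 1) {ε : ℝ} (hε : 0 < ε) {f g : ℂ → ℝ}
    (hf : Continuous f) (hg : Continuous g) (hfg : f p = g p) :
    ∃ f' g' : ℂ → ℝ, ∃ ρ : ℝ, 0 < ρ ∧ ρ ≤ 1 / 4 ∧ IsPerturbation ε f f' ∧
      IsPerturbation ε g g' ∧ (∀ z, f z = g z → f' z = g' z) ∧
      ∀ z, ‖z - p‖ < ρ → f' z = g' z := by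
  have h1 : ∀ᶠ z in 𝓝 p, |f z - f p| < ε / 4 :=
    ContinuousAt.eventually_lt (by fun_prop) continuousAt_const (by simpa using hε)
  have h2 : ∀ᶠ z in 𝓝 p, |g z - f p| < ε / 4 :=
    ContinuousAt.eventually_lt (by fun_prop) continuousAt_const (by simpa [hfg] using hε)
  obtain ⟨r, hr, hr'⟩ := Metric.eventually_nhds_iff.1 (h1.and h2)
  have hlt : ∀ z, ‖z - p‖ ≤ min (r / 2) (1 / 4) → dist z p < r := fun z hz => by
    rw [dist_eq_norm]
    linarith [hz.trans (min_le_left _ _)]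
  obtain ⟨lam, ρ, hρ, hρr, H⟩ := exists_isPerturbation hp hε (r := min (r / 2) (1 / 4))
    (by positivity) (min_le_right _ _) (f p - ε)
  obtain ⟨hf1, hf2⟩ := H f hf fun z hz => by simpa using (hr' (hlt z hz)).1
  obtain ⟨hg1, hg2⟩ := H g hg fun z hz => by simpa using (hr' (hlt z hz)).2
  refine ⟨_, _, ρ, hρ, hρr.trans (min_le_right _ _), hf1, hg1, fun z hz => ?_, fun z hz => ?_⟩
  · simp only [hz]
  · simp only [if_pos (hz.trans_le hρr), hf2 z hz, hg2 z hz]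

/-- A sequence of perturbations of sizes `2⁻ʲ` converges locally uniformly, so that its limit
inherits local sub-mean value inequalities. -/
theorem exists_limit {F : ℕ → ℂ → ℝ} (hc : Continuous (F 0))
    (h : ∀ j, IsPerturbation ((1 / 2) ^ j) (F j) (F (j + 1))) :
    ∃ f : ℂ → ℝ, Continuous f ∧ (∀ z, Tendsto (fun j => F j z) atTop (𝓝 (f z))) ∧
      ∀ q : ℂ → ℝ, Continuous q → ∀ U : Set ℂ, IsOpen U →
        (∀ j, ∀ y ∈ U, LocalSubMeanAt (fun z => F j z - q z) y) →
        ∀ a ∈ U, LocalSubMeanAt (fun z => f z - q z) a := by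
  have hFc : ∀ j, Continuous (F j) := fun j => by
    cases j with
    | zero => exact hc
    | succ j => exact (h j).continuous
  have hdist : ∀ z j, dist (F j z) (F (j + 1) z) ≤ 4 * (1 + ‖z‖) / 2 / 2 ^ j := by
    intro z j
    have h1 := (h j).le_apply z
    have h2 := (h j).apply_le z
    have hpos : (0 : ℝ) < (1 / 2) ^ j := by positivity
    have h3 : Real.log (max 1 ‖z‖) ≤ ‖z‖ := by
      refine (Real.log_le_sub_one_of_pos (lt_max_of_lt_left one_pos)).trans ?_
      have : max 1 ‖z‖ ≤ 1 + ‖z‖ := max_le (by linarith [norm_nonneg z]) (by linarith)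
      linarith
    have h4 := mul_le_mul_of_nonneg_left h3 hpos.le
    have h5 := mul_nonneg hpos.le (norm_nonneg z)
    have h6 : 4 * (1 + ‖z‖) / 2 / 2 ^ j = 2 * (1 / 2) ^ j + 2 * ((1 / 2) ^ j * ‖z‖) := by
      rw [one_div, inv_pow]; field_simp; ring
    rw [h6, dist_comm, Real.dist_eq, abs_le]
    constructor <;> linarith
  choose f hf using fun z => cauchySeq_tendsto_of_complete (cauchySeq_of_le_geometric_two (hdist z))
  have hlim : ∀ j z, dist (F j z) (f z) ≤ 4 * (1 + ‖z‖) / 2 ^ j := fun j z =>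
    dist_le_of_le_geometric_two_of_tendsto (hdist z) (hf z) j
  have happrox : ∀ a : ℂ, ∀ ε > 0, ∃ N, ∀ j ≥ N, ∀ y ∈ ball a 1, dist (F j y) (f y) ≤ ε := by
    intro a ε hε
    obtain ⟨N, hN⟩ := exists_pow_lt_of_lt_one (show (0 : ℝ) < ε / (4 * (2 + ‖a‖)) by positivity)
      (show (1 / 2 : ℝ) < 1 by norm_num)
    refine ⟨N, fun j hj y hy => (hlim j y).trans ?_⟩
    have h1 : ‖y‖ ≤ 1 + ‖a‖ := by
      have := norm_sub_norm_le y a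
      rw [← dist_eq_norm] at this
      linarith [mem_ball.1 hy]
    have h2 : ((1 : ℝ) / 2) ^ j ≤ (1 / 2) ^ N :=
      pow_le_pow_of_le_one (by norm_num) (by norm_num) hj
    have h3 : (1 / 2 : ℝ) ^ j * (4 * (2 + ‖a‖)) ≤ ε := by
      rw [lt_div_iff₀ (by positivity)] at hN
      exact (mul_le_mul_of_nonneg_right h2 (by positivity)).trans hN.le
    have h4 : 4 * (1 + ‖y‖) / 2 ^ j = (1 / 2 : ℝ) ^ j * (4 * (1 + ‖y‖)) := by
      rw [one_div, inv_pow]; field_simp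
    rw [h4]
    exact (mul_le_mul_of_nonneg_left (by linarith) (by positivity)).trans h3
  have hfc : Continuous f := by
    have h1 : TendstoLocallyUniformly F f atTop := by
      refine Metric.tendstoLocallyUniformly_iff.2 fun ε hε a =>
        ⟨ball a 1, ball_mem_nhds a one_pos, ?_⟩
      obtain ⟨N, hN⟩ := happrox a (ε / 2) (by positivity)
      filter_upwards [eventually_ge_atTop N] with j hj y hy
      rw [dist_comm]
      linarith [hN j hj y hy]
    exact h1.continuous (Frequently.of_forall hFc)
  refine ⟨f, hfc, hf, fun q hq U hU hs a ha => ?_⟩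
  refine localSubMeanAt_of_approx (F := fun j z => F j z - q z) hU ha
    (fun j => ((hFc j).sub hq).continuousOn) hs (hfc.sub hq).continuousOn
    (ball_mem_nhds a one_pos) fun ε hε => ?_
  obtain ⟨N, hN⟩ := happrox a ε hε
  refine ⟨N, fun y hy => ?_⟩
  have := hN N le_rfl y hy
  rwa [Real.dist_eq, ← sub_sub_sub_cancel_right _ _ (q y)] at this

/-- There are two subharmonic functions, one strictly subharmonic near the origin and the other
bounded at infinity, that coincide near each point of a given sequence in the unit circle. They
arise from `‖z‖ ^ 2 - 1` and `-log ‖z‖`, which agree on the circle, by countably many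
modifications near the given points. -/
theorem exists_pair_eq_near {p : ℕ → ℂ} (hp : ∀ j, ‖p j‖ = 1) :
    ∃ f₁ f₂ : ℂ → ℝ, ∃ ρ : ℕ → ℝ, Continuous f₁ ∧ Continuous f₂ ∧
      (∀ j, 0 < ρ j ∧ ρ j ≤ 1 / 4) ∧ (∀ a, LocalSubMeanAt f₁ a) ∧
      (∀ a, ‖a‖ < 1 / 2 → LocalSubMeanAt (fun z => f₁ z - ‖z‖ ^ 2) a) ∧
      (∀ a, 1 / 8 < ‖a‖ → LocalSubMeanAt f₂ a) ∧
      (∀ j z, ‖z - p j‖ < ρ j → f₁ z = f₂ z) ∧ (∀ z, ‖z‖ ≤ 8 → f₁ z ≤ 63) ∧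
      ∀ z, f₂ z ≤ 7 := by
  set F₁ : ℂ → ℝ := fun z => ‖z‖ ^ 2 - 1 with hF₁
  set F₂ : ℂ → ℝ := fun z => -Real.log (max ‖z - 0‖ (1 / 8)) with hF₂
  have hF₁c : Continuous F₁ := by fun_prop
  have hF₂c : Continuous F₂ := (continuous_log_max 0 (by norm_num)).neg
  let S := {q : (ℂ → ℝ) × (ℂ → ℝ) // Continuous q.1 ∧ Continuous q.2 ∧
    ∀ z, ‖z‖ = 1 → q.1 z = q.2 z}
  have hstep : ∀ (j : ℕ) (s : S), ∃ s' : S, ∃ ρ : ℝ, 0 < ρ ∧ ρ ≤ 1 / 4 ∧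
      IsPerturbation ((1 / 2) ^ j) s.1.1 s'.1.1 ∧ IsPerturbation ((1 / 2) ^ j) s.1.2 s'.1.2 ∧
      (∀ z, s.1.1 z = s.1.2 z → s'.1.1 z = s'.1.2 z) ∧
      ∀ z, ‖z - p j‖ < ρ → s'.1.1 z = s'.1.2 z := by
    rintro j ⟨⟨f, g⟩, hf, hg, hfg⟩
    obtain ⟨f', g', ρ, h1, h2, h3, h4, h5, h6⟩ := exists_isPerturbation_pair (hp j)
      (show (0 : ℝ) < (1 / 2) ^ j by positivity) hf hg (hfg _ (hp j))
    exact ⟨⟨⟨f', g'⟩, h3.continuous, h4.continuous, fun z hz => h5 z (hfg z hz)⟩, ρ, h1, h2, h3, h4,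
      h5, h6⟩
  choose next ρ hρ hρ4 hnext₁ hnext₂ hkeep hnear using hstep
  let s : ℕ → S := fun j => Nat.rec ⟨⟨F₁, F₂⟩, hF₁c, hF₂c, fun z hz => by
    simp only [hF₁, hF₂, sub_zero, hz]; norm_num⟩ next j
  obtain ⟨f₁, hf₁c, hf₁, hf₁s⟩ := exists_limit (F := fun j => (s j).1.1) hF₁c
    fun j => hnext₁ j (s j)
  obtain ⟨f₂, hf₂c, hf₂, hf₂s⟩ := exists_limit (F := fun j => (s j).1.2) hF₂c
    fun j => hnext₂ j (s j)
  refine ⟨f₁, f₂, fun j => ρ j (s j), hf₁c, hf₂c, fun j => ⟨hρ _ _, hρ4 _ _⟩, fun a => ?_,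
    fun a ha => ?_, fun a ha => ?_, fun j z hz => ?_, fun z hz => ?_, fun z => ?_⟩
  · have h0 : ∀ j a, LocalSubMeanAt (s j).1.1 a := by
      intro j
      induction j with
      | zero =>
        intro a
        exact (localSubMeanAt_norm_sq a).add (localSubMeanAt_const (-1) a)
          (Eventually.of_forall fun y => by fun_prop) (Eventually.of_forall fun y => by fun_prop)
      | succ j ih => exact fun a => (hnext₁ j (s j)).localSubMeanAt a (ih a)
    simpa using hf₁s (fun _ => 0) continuous_const univ isOpen_univ
      (fun j y _ => by simpa using h0 j y) a (mem_univ a)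
  · refine hf₁s (fun z => ‖z‖ ^ 2) (by fun_prop) (ball 0 (1 / 2)) isOpen_ball (fun j => ?_) a
      (by simpa using ha)
    induction j with
    | zero =>
      intro y _
      have : (fun z : ℂ => F₁ z - ‖z‖ ^ 2) = fun _ => (-1 : ℝ) := funext fun z => by
        simp only [hF₁]; ring
      change LocalSubMeanAt (fun z : ℂ => F₁ z - ‖z‖ ^ 2) y
      rw [this]
      exact localSubMeanAt_const _ _
    | succ j ih =>
      exact fun y hy => (hnext₁ j (s j)).localSubMeanAt_sub y (by simpa using hy) (ih y hy)
  · have hU : IsOpen {z : ℂ | 1 / 8 < ‖z‖} := isOpen_lt continuous_const continuous_norm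
    have h0 : ∀ j, ∀ a ∈ {z : ℂ | 1 / 8 < ‖z‖}, LocalSubMeanAt (s j).1.2 a := by
      intro j
      induction j with
      | zero =>
        intro a ha
        have ha0 : a ≠ 0 := norm_pos_iff.1 (lt_trans (by norm_num) ha)
        refine (localSubMeanAt_log_norm_sub (-1) ha0).congr ?_
        filter_upwards [hU.mem_nhds ha] with y hy
        have hy' : 1 / 8 < ‖y‖ := hy
        change _ = -Real.log (max ‖y - 0‖ (1 / 8))
        rw [max_eq_left (by simpa using hy'.le)]
        ring
      | succ j ih => exact fun a ha => (hnext₂ j (s j)).localSubMeanAt a (ih a ha)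
    simpa using hf₂s (fun _ => 0) continuous_const _ hU
      (fun j y hy => by simpa using h0 j y hy) a ha
  · refine tendsto_nhds_unique_of_eventuallyEq (hf₁ z) (hf₂ z) ?_
    filter_upwards [eventually_ge_atTop (j + 1)] with k hk
    induction k, hk using Nat.le_induction with
    | base => exact hnear j (s j) z hz
    | succ k _ ih => exact hkeep k (s k) z ih
  · refine le_of_tendsto (hf₁ z) (Eventually.of_forall fun j => ?_)
    induction j with
    | zero =>
      change ‖z‖ ^ 2 - 1 ≤ 63
      nlinarith [norm_nonneg z]
    | succ j ih => exact ((hnext₁ j (s j)).apply_le_of_norm_le z hz).trans ih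
  · have h0 : 0 ≤ Real.log (max 1 ‖z‖) := Real.log_nonneg (le_max_left _ _)
    have h1 : ∀ j, (s j).1.2 z ≤ F₂ z + (1 - (1 / 2) ^ j) * Real.log (max 1 ‖z‖) := by
      intro j
      induction j with
      | zero =>
        change F₂ z ≤ _
        simp
      | succ j ih =>
        have := (hnext₂ j (s j)).apply_le z
        change (s (j + 1)).1.2 z ≤ _ at this
        rw [pow_succ]
        linarith
    refine le_of_tendsto (hf₂ z) (Eventually.of_forall fun j => (h1 j).trans ?_)
    have h2 : (0 : ℝ) < (1 / 2) ^ j := by positivity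
    have h3 : -Real.log (max ‖z - 0‖ (1 / 8)) + Real.log (max 1 ‖z‖) ≤ 7 := by
      rw [neg_add_eq_sub, ← Real.log_div (lt_max_of_lt_left one_pos).ne'
        (lt_max_of_lt_right (by norm_num)).ne', sub_zero]
      have h4 : max 1 ‖z‖ / max ‖z‖ (1 / 8) ≤ 8 := by
        rw [div_le_iff₀ (lt_max_of_lt_right (by norm_num))]
        refine max_le ?_ ?_
        · linarith [le_max_right ‖z‖ (1 / 8)]
        · linarith [le_max_left ‖z‖ (1 / 8), norm_nonneg z]
      have h5 : 0 < max 1 ‖z‖ / max ‖z‖ (1 / 8) :=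
        div_pos (lt_max_of_lt_left one_pos) (lt_max_of_lt_right (by norm_num))
      linarith [Real.log_le_sub_one_of_pos h5]
    have h6 := mul_nonneg h2.le h0
    simp only [hF₂]
    linarith

end OneVariable

/-! ### The domain -/

section Weight

/-- The product of fractional powers of the distances to the points `p j`, `j < J`, with a small
power of `max 1 ‖z‖` as a correction which makes the sequence decreasing. It vanishes at the
points `p j` with `j < J`. -/
noncomputable def weight (p : ℕ → ℂ) (k : ℕ → ℕ) (J : ℕ) (z : ℂ) : ℝ :=
  (∏ j ∈ Finset.range J, (‖z - p j‖ / 2) ^ ((k j : ℝ)⁻¹)) *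
    max 1 ‖z‖ ^ ((2 ^ J : ℕ) : ℝ)⁻¹

variable {p : ℕ → ℂ} {k : ℕ → ℕ} {ρ : ℕ → ℝ}

theorem weight_zero (z : ℂ) : weight p k 0 z = max 1 ‖z‖ := by
  simp [weight]

theorem weight_nonneg (J : ℕ) (z : ℂ) : 0 ≤ weight p k J z := by
  unfold weight
  positivity

theorem continuous_weight (J : ℕ) : Continuous (weight p k J) := by
  unfold weight
  refine Continuous.mul (continuous_finsetProd _ fun j _ => ?_) ?_
  · exact Continuous.rpow_const (by fun_prop) fun z => Or.inr (by positivity)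
  · exact Continuous.rpow_const (by fun_prop) fun z => Or.inr (by positivity)

theorem weight_apply_eq_zero (hk : ∀ j, 2 ^ (j + 1) ≤ k j) {j J : ℕ} (hj : j < J) :
    weight p k J (p j) = 0 := by
  have hkj : (k j : ℝ)⁻¹ ≠ 0 := by
    have := (Nat.two_pow_pos (j + 1)).trans_le (hk j)
    positivity
  unfold weight
  rw [Finset.prod_eq_zero (Finset.mem_range.2 hj), zero_mul]
  simp [Real.zero_rpow hkj]

theorem weight_succ_le (hp : ∀ j, ‖p j‖ = 1) (hk : ∀ j, 2 ^ (j + 1) ≤ k j) (J : ℕ) (z : ℂ) :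
    weight p k (J + 1) z ≤ weight p k J z := by
  have hM : 1 ≤ max 1 ‖z‖ := le_max_left _ _
  have h2 : (0 : ℝ) < ((2 ^ (J + 1) : ℕ) : ℝ) := by positivity
  have h1 : (‖z - p J‖ / 2) ^ ((k J : ℝ)⁻¹) ≤ max 1 ‖z‖ ^ ((2 ^ (J + 1) : ℕ) : ℝ)⁻¹ := by
    have h3 : ‖z - p J‖ / 2 ≤ max 1 ‖z‖ := by
      have := norm_sub_le z (p J)
      rw [hp] at this
      linarith [le_max_right 1 ‖z‖]
    refine (Real.rpow_le_rpow (by positivity) h3 (by positivity)).trans ?_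
    refine Real.rpow_le_rpow_of_exponent_le hM ?_
    exact inv_anti₀ h2 (by exact_mod_cast hk J)
  have h4 : max 1 ‖z‖ ^ ((2 ^ (J + 1) : ℕ) : ℝ)⁻¹ * max 1 ‖z‖ ^ ((2 ^ (J + 1) : ℕ) : ℝ)⁻¹
      = max 1 ‖z‖ ^ ((2 ^ J : ℕ) : ℝ)⁻¹ := by
    rw [← Real.rpow_add (by positivity)]
    congr 1
    push_cast
    field_simp
    ring
  unfold weight
  rw [Finset.prod_range_succ, mul_assoc, ← h4]
  gcongr

theorem weight_antitone (hp : ∀ j, ‖p j‖ = 1) (hk : ∀ j, 2 ^ (j + 1) ≤ k j) (z : ℂ) :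
    Antitone fun J => weight p k J z :=
  antitone_nat_of_succ_le fun J => weight_succ_le hp hk J z

/-- Away from the points `p j`, the weights are bounded below uniformly in `J`. -/
theorem half_le_weight (hρ : ∀ j, 0 < ρ j)
    (hkρ : ∀ j, 1 - (1 / 2) ^ (j + 2) ≤ (ρ j / 2) ^ ((k j : ℝ)⁻¹)) {z : ℂ}
    (hz : ∀ j, ρ j ≤ ‖z - p j‖) (J : ℕ) : 1 / 2 ≤ weight p k J z := by
  have h1 : 1 / 2 + (1 / 2) ^ (J + 1)
      ≤ ∏ j ∈ Finset.range J, (‖z - p j‖ / 2) ^ ((k j : ℝ)⁻¹) := by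
    induction J with
    | zero => norm_num
    | succ J ih =>
      have h2 : (0 : ℝ) < (1 / 2) ^ (J + 2) := by positivity
      have h3 : (1 / 2 : ℝ) ^ (J + 2) ≤ 1 / 4 := by
        have : (1 / 2 : ℝ) ^ (J + 2) = (1 / 2) ^ J * (1 / 4) := by rw [pow_add]; norm_num
        rw [this]
        have : (1 / 2 : ℝ) ^ J ≤ 1 := pow_le_one₀ (by norm_num) (by norm_num)
        linarith
      have h4 : (1 / 2 : ℝ) ^ (J + 1) = 2 * (1 / 2) ^ (J + 2) := by rw [pow_succ _ (J + 1)]; ring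
      have h5 : (ρ J / 2) ^ ((k J : ℝ)⁻¹) ≤ (‖z - p J‖ / 2) ^ ((k J : ℝ)⁻¹) :=
        Real.rpow_le_rpow (by linarith [hρ J]) (by linarith [hz J]) (by positivity)
      rw [Finset.prod_range_succ]
      refine le_trans ?_ (mul_le_mul ih ((hkρ J).trans h5) (by linarith) (by positivity))
      rw [h4]
      nlinarith
  have h6 : 1 ≤ max 1 ‖z‖ ^ ((2 ^ J : ℕ) : ℝ)⁻¹ :=
    Real.one_le_rpow (le_max_left _ _) (by positivity)
  have h7 : (0 : ℝ) < (1 / 2) ^ (J + 1) := by positivity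
  unfold weight
  nlinarith

/-- The exponents `1 / k j` can be chosen as small as required by `weight_succ_le` and
`half_le_weight`. -/
theorem exists_exponents (hρ : ∀ j, 0 < ρ j) : ∃ k : ℕ → ℕ, (∀ j, 2 ^ (j + 1) ≤ k j) ∧
    ∀ j, 1 - (1 / 2) ^ (j + 2) ≤ (ρ j / 2) ^ ((k j : ℝ)⁻¹) := by
  have h : ∀ j, ∃ k : ℕ, 2 ^ (j + 1) ≤ k ∧ 1 - (1 / 2) ^ (j + 2) ≤ (ρ j / 2) ^ ((k : ℝ)⁻¹) := by
    intro j
    have h0 : ρ j / 2 ≠ 0 := (half_pos (hρ j)).ne'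
    have h1 : Tendsto (fun k : ℕ => (ρ j / 2) ^ ((k : ℝ)⁻¹)) atTop (𝓝 ((ρ j / 2) ^ (0 : ℝ))) :=
      (Real.continuousAt_const_rpow h0).tendsto.comp tendsto_inv_atTop_nhds_zero_nat
    rw [Real.rpow_zero] at h1
    have h2 : 1 - (1 / 2 : ℝ) ^ (j + 2) < 1 := by
      have : (0 : ℝ) < (1 / 2) ^ (j + 2) := by positivity
      linarith
    obtain ⟨k, hk1, hk2⟩ := ((eventually_ge_atTop (2 ^ (j + 1))).and
      (h1.eventually (lt_mem_nhds h2))).exists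
    exact ⟨k, hk1, hk2.le⟩
  choose k hk1 hk2 using h
  exact ⟨k, hk1, hk2⟩

/-- A suitable power of the weight, multiplied by the modulus of an entire function, is the
maximum of the moduli of two entire functions. -/
theorem exists_pow_weight_eq (hk : ∀ j, 2 ^ (j + 1) ≤ k j) (J : ℕ) {g H : ℂ → ℂ}
    (hg : Differentiable ℂ g) (hH : Differentiable ℂ H) :
    ∃ N : ℕ, N ≠ 0 ∧ ∃ A B : ℂ → ℂ, Differentiable ℂ A ∧ Differentiable ℂ B ∧
      ∀ ζ, (weight p k J (g ζ) * ‖H ζ‖) ^ N = max ‖A ζ‖ ‖B ζ‖ := by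
  have key : ∀ s : ℕ, ∃ N : ℕ, N ≠ 0 ∧ ∃ A B : ℂ → ℂ, Differentiable ℂ A ∧ Differentiable ℂ B ∧
      ∀ ζ, ((∏ j ∈ Finset.range s, (‖g ζ - p j‖ / 2) ^ ((k j : ℝ)⁻¹)) *
        (max 1 ‖g ζ‖ ^ ((2 ^ J : ℕ) : ℝ)⁻¹ * ‖H ζ‖)) ^ N = max ‖A ζ‖ ‖B ζ‖ := by
    intro s
    induction s with
    | zero =>
      refine ⟨2 ^ J, by positivity, fun ζ => H ζ ^ 2 ^ J, fun ζ => g ζ * H ζ ^ 2 ^ J, by fun_prop,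
        by fun_prop, fun ζ => ?_⟩
      rw [Finset.prod_range_zero, one_mul, mul_pow,
        Real.rpow_inv_natCast_pow (by positivity) (by positivity), norm_mul, norm_pow,
        max_mul_of_nonneg _ _ (by positivity), one_mul]
    | succ s ih =>
      obtain ⟨N, hN, A, B, hA, hB, hAB⟩ := ih
      have hks : k s ≠ 0 := ((Nat.two_pow_pos (s + 1)).trans_le (hk s)).ne'
      refine ⟨N * k s, mul_ne_zero hN hks, fun ζ => A ζ ^ k s * ((g ζ - p s) / 2) ^ N,
        fun ζ => B ζ ^ k s * ((g ζ - p s) / 2) ^ N, by fun_prop, by fun_prop, fun ζ => ?_⟩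
      have h1 : ((‖g ζ - p s‖ / 2) ^ ((k s : ℝ)⁻¹)) ^ (N * k s) = (‖g ζ - p s‖ / 2) ^ N := by
        rw [mul_comm, pow_mul, Real.rpow_inv_natCast_pow (by positivity) hks]
      have h2 : max ‖A ζ‖ ‖B ζ‖ ^ k s = max (‖A ζ‖ ^ k s) (‖B ζ‖ ^ k s) :=
        (pow_left_monotoneOn (n := k s)).map_max (norm_nonneg (A ζ)) (norm_nonneg (B ζ))
      rw [Finset.prod_range_succ, mul_right_comm, mul_pow, pow_mul, hAB, h1, h2, norm_mul,
        norm_mul, norm_pow, norm_pow, norm_pow, norm_div, Complex.norm_ofNat,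
        max_mul_of_nonneg _ _ (by positivity)]
  obtain ⟨N, hN, A, B, hA, hB, h⟩ := key J
  refine ⟨N, hN, A, B, hA, hB, fun ζ => ?_⟩
  rw [← h, weight, mul_assoc]

/-- The strict form of the maximum modulus principle on the unit disc. -/
theorem norm_lt_one_of_sphere {A : ℂ → ℂ} (hA : Differentiable ℂ A)
    (h : ∀ ζ : ℂ, ‖ζ‖ = 1 → ‖A ζ‖ < 1) {ζ : ℂ} (hζ : ‖ζ‖ ≤ 1) : ‖A ζ‖ < 1 := by
  obtain ⟨ξ, hξ, hmax⟩ := (isCompact_sphere (0 : ℂ) 1).exists_isMaxOn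
    ⟨1, by simp⟩ hA.continuous.norm.continuousOn
  refine lt_of_le_of_lt ?_ (h ξ (by simpa using hξ))
  refine Complex.norm_le_of_forall_mem_frontier_norm_le (U := ball 0 1) isBounded_ball
    hA.diffContOnCl (fun w hw => ?_) ?_
  · rw [frontier_ball _ one_ne_zero] at hw
    exact hmax hw
  · rw [closure_ball _ one_ne_zero]
    simpa using hζ

theorem weight_mul_norm_lt_one (hk : ∀ j, 2 ^ (j + 1) ≤ k j) (J : ℕ) {g H : ℂ → ℂ}
    (hg : Differentiable ℂ g) (hH : Differentiable ℂ H)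
    (h : ∀ ζ : ℂ, ‖ζ‖ = 1 → weight p k J (g ζ) * ‖H ζ‖ < 1) {ζ : ℂ} (hζ : ‖ζ‖ ≤ 1) :
    weight p k J (g ζ) * ‖H ζ‖ < 1 := by
  obtain ⟨N, hN, A, B, hA, hB, hAB⟩ := exists_pow_weight_eq (p := p) hk J hg hH
  have hnn : ∀ ζ, 0 ≤ weight p k J (g ζ) * ‖H ζ‖ := fun ζ =>
    mul_nonneg (weight_nonneg _ _) (norm_nonneg _)
  have h1 : ∀ ζ : ℂ, ‖ζ‖ = 1 → max ‖A ζ‖ ‖B ζ‖ < 1 := fun ζ hζ => by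
    rw [← hAB]
    exact pow_lt_one₀ (hnn ζ) (h ζ hζ) hN
  have h2 : (weight p k J (g ζ) * ‖H ζ‖) ^ N < 1 := by
    rw [hAB]
    exact max_lt (norm_lt_one_of_sphere hA (fun ζ hζ => (le_max_left _ _).trans_lt (h1 ζ hζ)) hζ)
      (norm_lt_one_of_sphere hB (fun ζ hζ => (le_max_right _ _).trans_lt (h1 ζ hζ)) hζ)
  exact (pow_lt_one_iff_of_nonneg (hnn ζ) hN).1 h2

end Weight

section Region
variable {m : ℕ} {p : ℕ → ℂ} {k : ℕ → ℕ} {ρ : ℕ → ℝ}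

/-- The region in `ℂⁿ` defined by the inequalities `weight p k J (x 0) * ‖h i x‖ < 1` for all `i`,
for some `J`. -/
def weightedRegion {ι : Type*} (p : ℕ → ℂ) (k : ℕ → ℕ) (h : ι → CSpace m → ℂ) : Set (CSpace m) :=
  ⋃ J : ℕ, {x | ∀ i, weight p k J (x 0) * ‖h i x‖ < 1}

variable {ι : Type*} {h : ι → CSpace m → ℂ}

theorem isOpen_weightedRegion [Finite ι] (hh : ∀ i, Continuous (h i)) (J : ℕ) :
    IsOpen {x : CSpace m | ∀ i, weight p k J (x 0) * ‖h i x‖ < 1} := by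
  rw [ofPred_forall]
  refine isOpen_iInter_of_finite fun i => isOpen_lt ?_ continuous_const
  exact ((continuous_weight J).comp (by fun_prop)).mul (hh i).norm

theorem hasDiscProperty_weightedRegion [Finite ι] (hp : ∀ j, ‖p j‖ = 1)
    (hk : ∀ j, 2 ^ (j + 1) ≤ k j) (hh : ∀ i, Differentiable ℂ (h i)) :
    HasDiscProperty (weightedRegion p k h) := by
  intro D hD hDU ζ hζ
  have hcpt : IsCompact (D '' sphere 0 1) := (isCompact_sphere 0 1).image hD.continuous
  obtain ⟨J, hJ⟩ := hcpt.elim_directed_cover _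
    (fun J => isOpen_weightedRegion (p := p) (k := k) (fun i => (hh i).continuous) J)
    (by rintro _ ⟨w, hw, rfl⟩; exact hDU w (by simpa using hw))
    (directed_of_isDirected_le fun J K hJK x hx i =>
      (mul_le_mul_of_nonneg_right (weight_antitone hp hk _ hJK) (norm_nonneg _)).trans_lt (hx i))
  refine mem_iUnion.2 ⟨J, fun i => ?_⟩
  refine weight_mul_norm_lt_one hk J (g := fun ζ => D ζ 0) (H := fun ζ => h i (D ζ)) ?_
    ((hh i).comp hD) (fun w hw => hJ (mem_image_of_mem D (by simpa using hw)) i) hζ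
  fun_prop

theorem mem_weightedRegion_of_mem_leaf (hk : ∀ j, 2 ^ (j + 1) ≤ k j) {j : ℕ} {x : CSpace m}
    (hx : x 0 = p j) : x ∈ weightedRegion p k h := by
  refine mem_iUnion.2 ⟨j + 1, fun i => ?_⟩
  rw [hx, weight_apply_eq_zero hk j.lt_succ_self, zero_mul]
  exact one_pos

theorem mem_weightedRegion_of_lt {x : CSpace m} (hx : ∀ i, max 1 ‖x 0‖ * ‖h i x‖ < 1) :
    x ∈ weightedRegion p k h :=
  mem_iUnion.2 ⟨0, fun i => by rw [weight_zero]; exact hx i⟩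

theorem norm_lt_two_of_mem_weightedRegion (hρ : ∀ j, 0 < ρ j)
    (hkρ : ∀ j, 1 - (1 / 2) ^ (j + 2) ≤ (ρ j / 2) ^ ((k j : ℝ)⁻¹)) {x : CSpace m}
    (hx : x ∈ weightedRegion p k h) (hz : ∀ j, ρ j ≤ ‖x 0 - p j‖) (i : ι) : ‖h i x‖ < 2 := by
  obtain ⟨J, hJ⟩ := mem_iUnion.1 hx
  have h1 := half_le_weight hρ hkρ hz J
  have h2 := hJ i
  nlinarith [norm_nonneg (h i x)]

/-- The polynomials `h` in the inequalities which bound the domain. The first one and the one of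
index `some 0` vanish on `x 0 * x 1 = 1`; where the weight is at least `1 / 2`, the inequalities
together force `x 0 * x 1` to be either near `1` or far from `1`. -/
noncomputable def boundingFunction (m : ℕ) : Option (Fin (m + 2)) → CSpace m → ℂ
  | none, x => 100 * (x 1 * (x 0 * x 1 - 1))
  | some i, x => if i = 0 then x 0 * (x 0 * x 1 - 1) / 2 else x i / 2

theorem differentiable_boundingFunction (i : Option (Fin (m + 2))) :
    Differentiable ℂ (boundingFunction m i) := by
  cases i with
  | none =>
    change Differentiable ℂ fun x : CSpace m => 100 * (x 1 * (x 0 * x 1 - 1))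
    fun_prop
  | some i =>
    change Differentiable ℂ fun x : CSpace m =>
      if i = 0 then x 0 * (x 0 * x 1 - 1) / 2 else x i / 2
    split_ifs <;> fun_prop

local notation "e₀" => (EuclideanSpace.single (0 : Fin (_ + 2)) (1 : ℂ))
local notation "e₁" => (EuclideanSpace.single (1 : Fin (_ + 2)) (1 : ℂ))

/-- If `‖x 0 * x 1 - 1‖` were equal to `1 / 2`, the bound on `x 1 * (x 0 * x 1 - 1)` would make
`x 1` small and hence `x 0` large, against the bound on `x 0 * (x 0 * x 1 - 1)`. -/
theorem norm_bounds_of_boundingFunction {x : CSpace m} (hx : ∀ i, ‖boundingFunction m i x‖ < 2) :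
    (1 / 8 < ‖x 0‖ ∧ ‖x 0 * x 1 - 1‖ < 1 / 2) ∨
      (1 / 2 < ‖x 0 * x 1 - 1‖ ∧ ‖x 0‖ < 8 ∧ ∀ i, i ≠ 0 → ‖x i‖ < 4) := by
  have hi : ∀ i, i ≠ 0 → ‖x i‖ < 4 := fun i h0 => by
    have := hx (some i)
    simp only [boundingFunction, if_neg h0, norm_div, Complex.norm_ofNat] at this
    linarith
  have h0 : ‖x 0‖ * ‖x 0 * x 1 - 1‖ < 4 := by
    have := hx (some 0)
    simp only [boundingFunction, if_true, norm_div, norm_mul, Complex.norm_ofNat] at this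
    linarith
  have h1 : ‖x 1‖ * ‖x 0 * x 1 - 1‖ < 1 / 50 := by
    have := hx none
    simp only [boundingFunction, norm_mul, Complex.norm_ofNat] at this
    linarith
  have hle : 1 ≤ ‖x 0‖ * ‖x 1‖ + ‖x 0 * x 1 - 1‖ := by
    have := norm_sub_le (x 0 * x 1) (x 0 * x 1 - 1)
    simpa using this
  have hx1 := hi 1 (by simp)
  have hn0 := norm_nonneg (x 0)
  have hn1 := norm_nonneg (x 1)
  set s := ‖x 0 * x 1 - 1‖
  rcases lt_or_ge s (1 / 2) with hs | hs
  · left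
    refine ⟨?_, hs⟩
    by_contra! h
    nlinarith
  · right
    have h8 : ‖x 0‖ < 8 := by nlinarith
    have h25 : ‖x 1‖ < 1 / 25 := by nlinarith
    refine ⟨?_, h8, hi⟩
    nlinarith

/-- The domain: it contains the leaves over the points `p j`, a neighbourhood of the unit disc in
the first coordinate, and the exterior part of the curve `ζ ↦ (ζ, ζ⁻¹)`; but at points whose first
coordinate is away from the points `p j`, the parts with `x 0 * x 1` near `1` and far from `1` are
separated from each other. -/
theorem exists_domain (m : ℕ) (hp : ∀ j, ‖p j‖ = 1) (hρ : ∀ j, 0 < ρ j ∧ ρ j ≤ 1 / 4) :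
    ∃ C : Set (CSpace m), IsPseudoconvexDomain C ∧
      (∀ j (x : CSpace m), x 0 = p j → x ∈ C) ∧
      (∀ x : CSpace m, ‖x 0‖ ≤ 1 → (∀ i, i ≠ 0 → ‖x i‖ < 1 / 200) → x ∈ C) ∧
      (∀ ζ : ℂ, 1 ≤ ‖ζ‖ → (ζ • e₀ + ζ⁻¹ • e₁ : CSpace m) ∈ C) ∧
      ∀ x ∈ C, (∀ j, ρ j ≤ ‖x 0 - p j‖) →
        (1 / 8 < ‖x 0‖ ∧ ‖x 0 * x 1 - 1‖ < 1 / 2) ∨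
          (1 / 2 < ‖x 0 * x 1 - 1‖ ∧ ‖x 0‖ < 8 ∧ ∀ i, i ≠ 0 → ‖x i‖ < 4) := by
  obtain ⟨k, hk, hkρ⟩ := exists_exponents fun j => (hρ j).1
  set U : Set (CSpace m) := weightedRegion p k (boundingFunction m) with hU
  have hUo : IsOpen U := isOpen_iUnion fun J =>
    isOpen_weightedRegion (fun i => (differentiable_boundingFunction i).continuous) J
  have hUD : HasDiscProperty U :=
    hasDiscProperty_weightedRegion hp hk differentiable_boundingFunction
  have hbounds : ∀ x ∈ U, (∀ j, ρ j ≤ ‖x 0 - p j‖) → ∀ i, ‖boundingFunction m i x‖ < 2 :=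
    fun x hx hz => norm_lt_two_of_mem_weightedRegion (fun j => (hρ j).1) hkρ hx hz
  -- the neighbourhood of the unit disc
  set W : Set (CSpace m) := {x | ‖x 0‖ ≤ 1 ∧ ∀ i, i ≠ 0 → ‖x i‖ < 1 / 200} with hW
  have hWU : W ⊆ U := by
    rintro x ⟨h0, hi⟩
    refine mem_weightedRegion_of_lt fun i => ?_
    rw [max_eq_left h0, one_mul]
    have hx1 := hi 1 (by simp)
    have hn0 := norm_nonneg (x 0)
    have hn1 := norm_nonneg (x 1)
    have hs : ‖x 0 * x 1 - 1‖ ≤ 1 + 1 / 200 := by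
      refine (norm_sub_le _ _).trans ?_
      rw [norm_mul, norm_one]
      nlinarith
    have hs0 := norm_nonneg (x 0 * x 1 - 1)
    cases i with
    | none =>
      simp only [boundingFunction, norm_mul, Complex.norm_ofNat]
      nlinarith
    | some i =>
      simp only [boundingFunction]
      split_ifs with h
      · simp only [norm_div, norm_mul, Complex.norm_ofNat]
        nlinarith
      · simp only [norm_div, Complex.norm_ofNat]
        linarith [hi i h]
  have hWc : Convex ℝ W := by
    have h1 : W = (fun x : CSpace m => x 0) ⁻¹' closedBall 0 1 ∩
        ⋂ i : Fin (m + 2), ⋂ _ : i ≠ 0, (fun x : CSpace m => x i) ⁻¹' ball 0 (1 / 200) := by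
      ext x
      simp [hW]
    rw [h1]
    have hlin : ∀ i : Fin (m + 2), IsLinearMap ℝ fun x : CSpace m => x i :=
      fun i => ⟨fun x y => rfl, fun c x => rfl⟩
    exact ((convex_closedBall _ _).is_linear_preimage (hlin 0)).inter
      (convex_iInter fun i => convex_iInter fun _ => (convex_ball _ _).is_linear_preimage (hlin i))
  have h0W : (0 : CSpace m) ∈ W := by simp [hW]
  set C := connectedComponentIn U 0 with hC
  have hCU : C ⊆ U := connectedComponentIn_subset _ _
  have hWC : W ⊆ C := hWc.isPreconnected.subset_connectedComponentIn h0W hWU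
  have hleaf : ∀ j (x : CSpace m), x 0 = p j → x ∈ C := by
    intro j x hx
    have h1 : Convex ℝ ((fun x : CSpace m => x 0) ⁻¹' {p j}) :=
      (convex_singleton _).is_linear_preimage ⟨fun x y => rfl, fun c x => rfl⟩
    have h2 : p j • (e₀ : CSpace m) ∈ C := hWC (by
      refine ⟨by simp [hp], fun i hi => ?_⟩
      simp [hi])
    rw [hC, connectedComponentIn_eq h2]
    exact h1.isPreconnected.subset_connectedComponentIn (by simp)
      (fun y hy => mem_weightedRegion_of_mem_leaf hk hy) hx
  have hcurve : ∀ ζ : ℂ, 1 ≤ ‖ζ‖ → (ζ • e₀ + ζ⁻¹ • e₁ : CSpace m) ∈ C := by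
    intro ζ hζ
    set T : ℂ → CSpace m := fun s => Complex.exp s • e₀ + Complex.exp (-s) • e₁
    have hT : Continuous T := by fun_prop
    have hlog : ∀ ζ : ℂ, 1 ≤ ‖ζ‖ → T (Complex.log ζ) = ζ • e₀ + ζ⁻¹ • e₁ := by
      intro ζ hζ
      have h0 : ζ ≠ 0 := norm_pos_iff.1 (one_pos.trans_le hζ)
      simp only [T, Complex.exp_neg, Complex.exp_log h0]
    have hmem : ∀ ζ : ℂ, 1 ≤ ‖ζ‖ →
        ζ • e₀ + ζ⁻¹ • e₁ ∈ T '' {s | 0 ≤ s.re} := fun ζ hζ =>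
      ⟨Complex.log ζ, (Real.log_nonneg hζ).trans_eq (Complex.log_re ζ).symm, hlog ζ hζ⟩
    have h1 : IsPreconnected (T '' {s | 0 ≤ s.re}) :=
      (convex_halfSpace_re_ge 0).isPreconnected.image T hT.continuousOn
    have h2 : (p 0 • e₀ + (p 0)⁻¹ • e₁ : CSpace m) ∈ C := hleaf 0 _ (by simp)
    rw [hC, connectedComponentIn_eq h2]
    refine h1.subset_connectedComponentIn (hmem _ (hp 0).ge) ?_ (hmem ζ hζ)
    rintro _ ⟨s, hs, rfl⟩
    have hs1 : 1 ≤ ‖Complex.exp s‖ := by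
      rw [Complex.norm_exp]
      exact Real.one_le_exp hs
    have hz : T s 0 = Complex.exp s := by simp [T]
    have hz1 : T s 1 = Complex.exp (-s) := by simp [T]
    have hz01 : T s 0 * T s 1 - 1 = 0 := by
      rw [hz, hz1, ← Complex.exp_add, add_neg_cancel, Complex.exp_zero, sub_self]
    refine mem_weightedRegion_of_lt fun i => ?_
    rw [hz, max_eq_right hs1]
    cases i with
    | none => simp [boundingFunction, hz01]
    | some i =>
      simp only [boundingFunction, hz01]
      split_ifs with h
      · simp
      · by_cases h' : i = 1
        · subst h'
          rw [hz1, norm_div, ← mul_div_assoc, ← norm_mul, ← Complex.exp_add, add_neg_cancel,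
            Complex.exp_zero]
          norm_num
        · have : T s i = 0 := by simp [T, h, h']
          rw [this]
          simp
  refine ⟨C, ?_, hleaf, fun x h1 h2 => hWC ⟨h1, h2⟩, hcurve, fun x hx hz =>
    norm_bounds_of_boundingFunction (hbounds x (hCU hx) hz)⟩
  refine (hUD.connectedComponentIn 0).isPseudoconvexDomain hUo.connectedComponentIn
    (isConnected_connectedComponentIn_iff.2 (hWU h0W)) ⟨(10 : ℂ) • e₀, fun h10 => ?_⟩
  -- the point `(10, 0, …, 0)` lies in the complement
  have h1 : ∀ j, ρ j ≤ ‖((10 : ℂ) • e₀ : CSpace m) 0 - p j‖ := by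
    intro j
    have := norm_sub_norm_le (10 : ℂ) (p j)
    rw [hp, Complex.norm_ofNat] at this
    have h2 : ((10 : ℂ) • e₀ : CSpace m) 0 = 10 := by simp
    rw [h2]
    linarith [(hρ j).2]
  have h2 := hbounds _ (hCU h10) h1 (some 0)
  simp [boundingFunction] at h2
  norm_num at h2

end Region

/-! ### The continuous plurisubharmonic function -/

section ContinuousFunction
variable {m : ℕ}

theorem LocalSubMeanAt.comp_apply_zero {f : ℂ → ℝ} {a : CSpace m} (h : LocalSubMeanAt f (a 0)) :
    LocalSubMeanAt (fun x : CSpace m => f (x 0)) a := by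
  intro b
  filter_upwards [h (b 0)] with t ht
  simpa using ht

/-- A continuous plurisubharmonic function that is strictly plurisubharmonic near the origin. On the
part of the domain where `x 0 * x 1` is near `1` it is `f₂ (x 0)`, on the other part it is
`f₁ (x 0)`, improved near the origin by a multiple of `‖x‖ ^ 2`. The two parts of the domain are
connected with each other only where `f₁ (x 0) = f₂ (x 0)`. -/
theorem exists_psh_isStrictlyPSHOn {C : Set (CSpace m)} (hC : IsOpen C)
    (hball : ball (0 : CSpace m) (1 / 200) ⊆ C) {p : ℕ → ℂ} {ρ : ℕ → ℝ} (hp : ∀ j, ‖p j‖ = 1)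
    (hρ : ∀ j, 0 < ρ j ∧ ρ j ≤ 1 / 4)
    (hbd : ∀ x ∈ C, (∀ j, ρ j ≤ ‖x 0 - p j‖) →
        (1 / 8 < ‖x 0‖ ∧ ‖x 0 * x 1 - 1‖ < 1 / 2) ∨
          (1 / 2 < ‖x 0 * x 1 - 1‖ ∧ ‖x 0‖ < 8 ∧ ∀ i, i ≠ 0 → ‖x i‖ < 4))
    {f₁ f₂ : ℂ → ℝ} (hf₁ : Continuous f₁) (hf₂ : Continuous f₂) (hs₁ : ∀ a, LocalSubMeanAt f₁ a)
    (hs₁' : ∀ a, ‖a‖ < 1 / 2 → LocalSubMeanAt (fun z => f₁ z - ‖z‖ ^ 2) a)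
    (hs₂ : ∀ a, 1 / 8 < ‖a‖ → LocalSubMeanAt f₂ a)
    (heq : ∀ j z, ‖z - p j‖ < ρ j → f₁ z = f₂ z) (hb₁ : ∀ z, ‖z‖ ≤ 8 → f₁ z ≤ 63)
    (hb₂ : ∀ z, f₂ z ≤ 7) :
    ∃ φ : CSpace m → ℝ, ContinuousOn φ C ∧ IsPSHOn φ C ∧ (∀ x ∈ C, φ x < 0) ∧
      IsStrictlyPSHOn φ (ball 0 (1 / 200)) := by
  -- `σ` is so small that `σ * ‖x‖ ^ 2 + 1 / 50 < ‖x 0‖ ^ 2` on the part near the disc if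
  -- `1 / 3 < ‖x 0‖ < 1 / 2`; there the maximum in `φ` is `g₁`, while near the origin it is `g₃`
  set σ : ℝ := 1 / (800 * (m + 2)) with hσdef
  have hσ : 0 < σ := by positivity
  set g₁ : CSpace m → ℝ := fun x => f₁ (x 0) + -100
  set g₂ : CSpace m → ℝ := fun x => f₂ (x 0) + -100
  set g₃ : CSpace m → ℝ := fun x => (f₁ (x 0) - ‖x 0‖ ^ 2) + (σ * ‖x‖ ^ 2 + (1 / 50 - 100))
  set φ : CSpace m → ℝ := fun x => if ‖x 0 * x 1 - 1‖ < 1 / 2 then g₂ x else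
    if ‖x 0‖ < 1 / 2 then max (g₁ x) (g₃ x) else g₁ x with hφ
  have hg₁ : Continuous g₁ := by fun_prop
  have hg₂ : Continuous g₂ := by fun_prop
  have hg₃ : Continuous g₃ := by fun_prop
  have hev : ∀ {g : CSpace m → ℝ} (_ : Continuous g) (a : CSpace m),
      ∀ᶠ y in 𝓝 a, ContinuousAt g y := fun hg a =>
    Eventually.of_forall fun y => hg.continuousAt
  have hfar : ∀ z : ℂ, ‖z‖ < 1 / 2 → ∀ j, ρ j ≤ ‖z - p j‖ := by
    intro z hz j
    have := norm_sub_norm_le (p j) z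
    rw [hp, norm_sub_rev] at this
    linarith [(hρ j).2]
  have hnear : ∀ z j, ‖z - p j‖ < ρ j → 1 / 2 < ‖z‖ ∧ ‖z‖ ≤ 8 := by
    intro z j hz
    have h1 := norm_sub_norm_le (p j) z
    have h2 := norm_sub_norm_le z (p j)
    rw [hp, norm_sub_rev] at h1
    rw [hp] at h2
    have := (hρ j).2
    constructor <;> linarith
  have hnorm : ∀ x : CSpace m, ‖x 0‖ < 1 / 2 → (∀ i, i ≠ 0 → ‖x i‖ < 4) → σ * ‖x‖ ^ 2 ≤ 1 / 50 := by
    intro x h0 hi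
    have h1 : ‖x‖ ^ 2 ≤ (m + 2) * 16 := by
      rw [EuclideanSpace.norm_sq_eq]
      have : ∀ i ∈ Finset.univ, ‖x i‖ ^ 2 ≤ 16 := by
        intro i _
        have h4 : ‖x i‖ ≤ 4 := by
          rcases eq_or_ne i 0 with rfl | h
          · linarith
          · exact (hi i h).le
        nlinarith [norm_nonneg (x i)]
      simpa using Finset.sum_le_card_nsmul _ _ _ this
    calc σ * ‖x‖ ^ 2 ≤ σ * ((m + 2) * 16) := by gcongr
      _ = 1 / 50 := by rw [hσdef]; field_simp; norm_num
  have hsplit : ∀ x ∈ C, ‖x 0‖ < 1 / 2 → ¬ ‖x 0 * x 1 - 1‖ < 1 / 2 → σ * ‖x‖ ^ 2 ≤ 1 / 50 := by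
    intro x hx h0 h1
    rcases hbd x hx (hfar _ h0) with h | h
    · exact absurd h.2 h1
    · exact hnorm x h0 h.2.2
  have hls₁ : ∀ a, LocalSubMeanAt g₁ a := fun a =>
    (hs₁ (a 0)).comp_apply_zero.add (localSubMeanAt_const (-100) a) (hev (by fun_prop) a)
      (hev continuous_const a)
  have hls₂ : ∀ a : CSpace m, 1 / 8 < ‖a 0‖ → LocalSubMeanAt g₂ a := fun a ha =>
    (hs₂ (a 0) ha).comp_apply_zero.add (localSubMeanAt_const (-100) a) (hev (by fun_prop) a)
      (hev continuous_const a)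
  have hls₃' : ∀ a : CSpace m, ‖a 0‖ < 1 / 2 →
      LocalSubMeanAt (fun x : CSpace m => f₁ (x 0) - ‖x 0‖ ^ 2) a := fun a ha =>
    (hs₁' (a 0) ha).comp_apply_zero
  have hls₃ : ∀ a : CSpace m, ‖a 0‖ < 1 / 2 → LocalSubMeanAt g₃ a := fun a ha =>
    (hls₃' a ha).add (((localSubMeanAt_norm_sq a).const_mul hσ.le).add
      (localSubMeanAt_const _ a) (hev (by fun_prop) a) (hev continuous_const a))
      (hev (by fun_prop) a) (hev (by fun_prop) a)
  -- locally `φ` is given by one of the formulas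
  have hlocal : ∀ a ∈ C, ∃ g : CSpace m → ℝ, Continuous g ∧ LocalSubMeanAt g a ∧ g =ᶠ[𝓝 a] φ := by
    intro a ha
    by_cases hN : ∃ j, ‖a 0 - p j‖ < ρ j
    · obtain ⟨j, hj⟩ := hN
      refine ⟨g₁, hg₁, hls₁ a, ?_⟩
      have h1 : ∀ᶠ x : CSpace m in 𝓝 a, ‖x 0 - p j‖ < ρ j :=
        ContinuousAt.eventually_lt (by fun_prop) continuousAt_const hj
      filter_upwards [h1] with x hx
      simp only [hφ, if_neg (not_lt.2 (hnear _ j hx).1.le)]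
      split_ifs
      · simp only [g₁, g₂, heq j _ hx]
      · rfl
    push Not at hN
    rcases hbd a ha hN with ⟨h8, hlt⟩ | ⟨hgt, -, -⟩
    · refine ⟨g₂, hg₂, hls₂ a h8, ?_⟩
      have h1 : ∀ᶠ x : CSpace m in 𝓝 a, ‖x 0 * x 1 - 1‖ < 1 / 2 :=
        ContinuousAt.eventually_lt (by fun_prop) continuousAt_const hlt
      filter_upwards [h1] with x hx
      simp only [hφ, if_pos hx]
    have h1 : ∀ᶠ x : CSpace m in 𝓝 a, 1 / 2 < ‖x 0 * x 1 - 1‖ :=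
      ContinuousAt.eventually_lt continuousAt_const (by fun_prop) hgt
    rcases lt_or_ge ‖a 0‖ (1 / 2) with h0 | h0
    · refine ⟨fun x => max (g₁ x) (g₃ x), hg₁.max hg₃,
        (hls₁ a).max (hls₃ a h0) (hev hg₁ a) (hev hg₃ a), ?_⟩
      have h2 : ∀ᶠ x : CSpace m in 𝓝 a, ‖x 0‖ < 1 / 2 :=
        ContinuousAt.eventually_lt (by fun_prop) continuousAt_const h0
      filter_upwards [h1, h2] with x hx1 hx2
      simp only [hφ, if_neg (not_lt.2 hx1.le), if_pos hx2]
    · refine ⟨g₁, hg₁, hls₁ a, ?_⟩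
      have h2 : ∀ᶠ x : CSpace m in 𝓝 a, 1 / 3 < ‖x 0‖ :=
        ContinuousAt.eventually_lt continuousAt_const (by fun_prop) (by linarith)
      filter_upwards [h1, h2, hC.mem_nhds ha] with x hx1 hx2 hx3
      simp only [hφ, if_neg (not_lt.2 hx1.le)]
      split_ifs with hx4
      · refine (max_eq_left ?_).symm
        have := hsplit x hx3 hx4 (not_lt.2 hx1.le)
        simp only [g₁, g₃]
        nlinarith
      · rfl
  have hφc : ContinuousOn φ C := fun a ha => by
    obtain ⟨g, hg, -, h⟩ := hlocal a ha
    exact (hg.continuousAt.congr h).continuousWithinAt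
  refine ⟨φ, hφc, isPSHOn_of_localSubMeanAt hC hφc fun a ha => ?_, fun x hx => ?_,
    fun θ hθ hθs _ => ?_⟩
  · obtain ⟨g, -, hg, h⟩ := hlocal a ha
    exact hg.congr h
  · have h1 : ‖x 0‖ ≤ 8 → g₁ x < 0 := fun h => by
      have := hb₁ _ h
      simp only [g₁]
      linarith
    simp only [hφ]
    split_ifs with h h'
    · have := hb₂ (x 0)
      simp only [g₂]
      linarith
    · refine max_lt (h1 (by linarith)) ?_
      have h2 := hsplit x hx h' h
      have h3 := hb₁ (x 0) (by linarith)
      simp only [g₃]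
      nlinarith [norm_nonneg (x 0)]
    · refine h1 ?_
      by_cases hN : ∃ j, ‖x 0 - p j‖ < ρ j
      · obtain ⟨j, hj⟩ := hN
        exact (hnear _ j hj).2
      · push Not at hN
        rcases hbd x hx hN with h2 | h2
        exacts [absurd h2.2 h, h2.2.1.le]
  · obtain ⟨ε₀, hε₀, hθε⟩ := exists_localSubMeanAt_add hθ hθs hσ
    refine ⟨ε₀, hε₀, fun ε hε => ?_⟩
    have hin : ∀ x ∈ ball (0 : CSpace m) (1 / 200), φ x = g₃ x ∧ ‖x 0‖ < 1 / 2 := by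
      intro x hx
      have hx' : ‖x‖ < 1 / 200 := by simpa using hx
      have h0 : ‖x 0‖ < 1 / 200 := (PiLp.norm_apply_le x 0).trans_lt hx'
      have h1 : ‖x 1‖ < 1 / 200 := (PiLp.norm_apply_le x 1).trans_lt hx'
      have h2 : 1 / 2 ≤ ‖x 0 * x 1 - 1‖ := by
        have := norm_sub_norm_le 1 (x 0 * x 1)
        rw [norm_sub_rev, norm_one, norm_mul] at this
        nlinarith [norm_nonneg (x 0), norm_nonneg (x 1)]
      have h3 : ‖x 0‖ < 1 / 2 := by linarith
      refine ⟨?_, h3⟩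
      simp only [hφ, if_neg (not_lt.2 h2), if_pos h3]
      refine max_eq_right ?_
      simp only [g₁, g₃]
      have : 0 ≤ σ * ‖x‖ ^ 2 := by positivity
      nlinarith [norm_nonneg (x 0)]
    refine isPSHOn_of_localSubMeanAt isOpen_ball ?_ fun a ha => ?_
    · exact (hφc.mono hball).add (continuous_const.mul hθ.continuous).continuousOn
    · have h1 : LocalSubMeanAt (fun x : CSpace m => (f₁ (x 0) - ‖x 0‖ ^ 2) +
          ((σ * ‖x‖ ^ 2 + ε * θ x) + (1 / 50 - 100))) a := by
        have hθc := hθ.continuous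
        exact (hls₃' a (hin a ha).2).add ((hθε ε hε a).add (localSubMeanAt_const _ a)
          (hev (by fun_prop) a) (hev continuous_const a)) (hev (by fun_prop) a)
          (hev (by fun_prop) a)
      refine h1.congr ?_
      filter_upwards [isOpen_ball.mem_nhds ha] with x hx
      rw [(hin x hx).1]
      simp only [g₃]
      ring

end ContinuousFunction

/-! ### Constancy on an open set and the cores -/

/-- Adding a small multiple of a bump function at `z` to a function which is constant near `z`
violates the sub-mean value inequality. -/
theorem not_isStrictlyPSHOn_of_eventuallyEq_const {n : ℕ} [NeZero n]
    {f : EuclideanSpace ℂ (Fin n) → ℝ} {U : Set (EuclideanSpace ℂ (Fin n))}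
    {z : EuclideanSpace ℂ (Fin n)} (hU : U ∈ 𝓝 z) {c : ℝ}
    (hf : ∀ᶠ x in 𝓝 z, f x = c) : ¬ IsStrictlyPSHOn f U := by
  intro hs
  obtain ⟨r, hr, hrU⟩ := Metric.nhds_basis_closedBall.mem_iff.1 (inter_mem hU hf)
  have : FiniteDimensional ℝ (EuclideanSpace ℂ (Fin n)) := FiniteDimensional.complexToReal _
  let θ : ContDiffBump z := ⟨r / 2, r, by positivity, by linarith⟩
  obtain ⟨ε₀, hε₀, h⟩ := hs θ θ.contDiff θ.hasCompactSupport
    (by rw [θ.tsupport_eq]; exact fun x hx => (hrU hx).1)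
  set b : EuclideanSpace ℂ (Fin n) := (r : ℂ) • EuclideanSpace.single 0 1 with hb
  have hbn : ‖b‖ = r := by simp [hb, norm_smul, abs_of_pos hr]
  have hdisc : ∀ ζ : ℂ, ‖ζ‖ ≤ 1 → z + ζ • b ∈ closedBall z r := fun ζ hζ => by
    rw [mem_closedBall, dist_eq_norm, add_sub_cancel_left, norm_smul, hbn]
    nlinarith
  have h1 := ((h (ε₀ / 2) (by rw [abs_of_pos] <;> linarith)).2 z b
    fun ζ hζ => (hrU (hdisc ζ hζ)).1).2
  have h2 : circleAverage (fun ζ : ℂ => f (z + ζ • b) + ε₀ / 2 * θ (z + ζ • b)) 0 1 = c := by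
    rw [← avg_const c]
    refine avg_congr fun ζ hζ => ?_
    have h3 : θ (z + ζ • b) = 0 := θ.zero_of_le_dist (by
      rw [dist_eq_norm, add_sub_cancel_left, norm_smul, hbn, hζ, one_mul])
    have h4 : f (z + ζ • b) = c := (hrU (hdisc ζ hζ.le)).2
    rw [h3, h4, mul_zero, add_zero]
  have h5 : f z = c := hf.self_of_nhds
  have h6 : θ z = 1 := θ.one_of_mem_closedBall (mem_closedBall_self (by positivity))
  simp only [h2, h5, h6] at h1
  linarith

theorem theorem2 (n : ℕ) (hn : 2 ≤ n) :
    ∃ Ω ω : Set (EuclideanSpace ℂ (Fin n)),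
      IsPseudoconvexDomain Ω ∧ IsOpen ω ∧ ω.Nonempty ∧ ω ⊆ Ω ∧
      (∃ φ : EuclideanSpace ℂ (Fin n) → ℝ,
        IsPSHOfClassOn 0 φ Ω ∧ (∀ z ∈ Ω, φ z < 0) ∧ IsStrictlyPSHOn φ ω) ∧
      (∀ φ : EuclideanSpace ℂ (Fin n) → ℝ,
        IsPSHOfClassOn 1 φ Ω → (∀ z ∈ Ω, φ z < 0) → ∃ c : ℝ, ∀ z ∈ ω, φ z = c) ∧
      pshCore 0 Ω ≠ pshCore 1 Ω := by
  obtain ⟨m, rfl⟩ := Nat.exists_eq_add_of_le' hn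
  set p : ℕ → ℂ := fun j => (TopologicalSpace.denseSeq Circle j : ℂ)
  have hp1 : ∀ j, ‖p j‖ = 1 := fun j => Circle.norm_coe _
  have hp : sphere (0 : ℂ) 1 ⊆ closure (range p) := by
    intro z hz
    have h1 := TopologicalSpace.denseRange_denseSeq Circle
      ⟨z, by simpa [Submonoid.unitSphere] using hz⟩
    refine map_mem_closure (f := fun z : Circle => (z : ℂ)) (by fun_prop) h1 ?_
    rintro _ ⟨j, rfl⟩
    exact mem_range_self j
  obtain ⟨f₁, f₂, ρ, hf₁, hf₂, hρ, hs₁, hs₁', hs₂, heq, hb₁, hb₂⟩ := exists_pair_eq_near hp1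
  obtain ⟨C, hCpsc, hleaf, hdisc, hcurve, hbd⟩ := exists_domain m hp1 hρ
  have hC : IsOpen C := hCpsc.1
  have hball : ball (0 : CSpace m) (1 / 200) ⊆ C := by
    intro x hx
    have hx' : ‖x‖ < 1 / 200 := by simpa using hx
    exact hdisc x (by linarith [PiLp.norm_apply_le x 0])
      fun i _ => (PiLp.norm_apply_le x i).trans_lt hx'
  obtain ⟨φ, hφc, hφ, hφneg, hφs⟩ := exists_psh_isStrictlyPSHOn hC hball hp1 hρ hbd hf₁ hf₂ hs₁ hs₁'
    hs₂ heq hb₁ hb₂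
  have hφ0 : IsPSHOfClassOn 0 φ C := ⟨hφ, contDiffOn_zero.2 hφc⟩
  have hconst : ∀ ψ : CSpace m → ℝ, IsPSHOfClassOn 1 ψ C → ∀ B, (∀ x ∈ C, ψ x ≤ B) →
      ∃ c, ∀ x ∈ ball (0 : CSpace m) (1 / 200), ψ x = c := by
    rintro ψ ⟨hψ, hψ1⟩ B hB
    refine ⟨ψ ((2 : ℂ) • EuclideanSpace.single 0 1 + (2 : ℂ)⁻¹ • EuclideanSpace.single 1 1),
      fun x hx => ?_⟩
    have hx' : ‖x‖ < 1 / 200 := by simpa using hx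
    have h0 : ‖x 0‖ ≤ 1 := by linarith [PiLp.norm_apply_le x 0]
    have key := eq_of_disc_of_exterior_curve hC hψ hψ1 hB hleaf hp1 hp
      (w := x - x 0 • EuclideanSpace.single 0 1) (by simp) (fun ζ hζ => ?_) hcurve h0
    · rwa [add_sub_cancel] at key
    · refine hdisc _ (by simpa using hζ) fun i hi => ?_
      simpa [hi] using (PiLp.norm_apply_le x i).trans_lt hx'
  have h0 : (0 : CSpace m) ∈ ball (0 : CSpace m) (1 / 200) := mem_ball_self (by norm_num)
  refine ⟨C, ball 0 (1 / 200), hCpsc, isOpen_ball, ⟨0, h0⟩, hball, ⟨φ, hφ0, hφneg, hφs⟩,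
    fun ψ hψ hneg => hconst ψ hψ 0 fun x hx => (hneg x hx).le, fun hcore => ?_⟩
  have h1 : (0 : CSpace m) ∈ pshCore 1 C := by
    refine ⟨hball h0, fun f hf ⟨B, hB⟩ ⟨U, hU, h0U, _, hs⟩ => ?_⟩
    obtain ⟨c, hc⟩ := hconst f hf B fun x hx => hB (mem_image_of_mem f hx)
    exact not_isStrictlyPSHOn_of_eventuallyEq_const (hU.mem_nhds h0U)
      (eventually_of_mem (isOpen_ball.mem_nhds h0) hc) hs
  rw [← hcore] at h1
  exact h1.2 φ hφ0 ⟨0, by rintro _ ⟨x, hx, rfl⟩; exact (hφneg x hx).le⟩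
    ⟨ball 0 (1 / 200), isOpen_ball, h0, hball, hφs⟩
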